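/- Let $E \subset \mathbb{R}^n$ be a bounded set. For a bounded set $F$ and $r>0$ let $N(F,r)$ be the minimal number of sets of diameter at most $r$ needed to cover $F$. For $0<\theta<1$ let the (upper) $\theta$-intermediate dimension $\dim_\theta E$ be the infimum of those $s>0$ for which there are $C,\delta_0>0$ such that for every $\delta\in(0,\delta_0)$ the set $E$ can be covered by sets $A_i \subset \mathbb{R}^n$ with $\delta^{1/\theta}\le\operatorname{diam}A_i\le\delta$ for all $i$ and $\sum_i(\operatorname{diam}A_i)^s\le C$; let $\dim_{qH}E=\lim_{\theta\searrow0}\dim_\theta E$ be the quasi-Hausdorff dimension. Let the $\theta$-Assouad spectrum $\dim_A^\theta E$ be the infimum of those $s>0$ for which there is $C>0$ with $N(B(x,R)\cap E,r)\le C(R/r)^s$ whenever $x\in E$ and $0<r\le R^{1/\theta}<R<1$. The (upper) box-counting dimension $\dim_B Y$ of a metric space $Y$ is the infimum of those $s>0$ for which there is $C>0$ with $N(Y,r)\le Cr^{-s}$ for all $0<r<\operatorname{diam}Y$. A homeomorphism $f:X\to Y$ of metric spaces $(X,d)$, $(Y,d')$ is quasisymmetric if there is an increasing homeomorphism $\eta:[0,\infty)\to[0,\infty)$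 such that $d'(f(x),f(y))\le\eta(t)\,d'(f(x),f(z))$ whenever $x,y,z \in X$, $t>0$ and $d(x,y)\le t\,d(x,z)$. A homeomorphism $f:\mathbb{R}^n\to\mathbb{R}^n$ is quasiconformal if $$\sup_{x}\ \limsup_{r\to0}\frac{\sup_{|y-x|=r}|f(y)-f(x)|}{\inf_{|y-x|=r}|f(y)-f(x)|}<\infty ,$$ and, when $n=1$, $f$ is moreover quasisymmetric. The conformal box-counting dimension $C\dim_B E$ is the infimum of $\dim_B Y$ over all metric spaces $Y$ that are images of $E$ under a quasisymmetric homeomorphism. Theorem (Fraser--Tyson). If $E\subset\mathbb{R}^n$ is bounded and $\dim_{qH}E<1$, then for each $0<\theta<1$ $$\inf\{\dim_A^\theta f(E)\ :\ f:\mathbb{R}^n\to\mathbb{R}^n\text{ quasiconformal}\}=0 ,$$ and in particular $C\dim_B E=0$. -/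

import Mathlib

open Set Filter Topology
open scoped NNReal ENNReal

noncomputable section

/-! ### Covering numbers and dimensions

All dimensions take values in `ℝ≥0∞`, so that the infimum of an empty set of exponents is `∞`. -/

/-- `N(F, r)`: the minimal number of sets of diameter at most `r` needed to cover `F`
(equal to `∞` when no finite cover exists). -/
def diamCoveringNumber {X : Type*} [MetricSpace X] (F : Set X) (r : ℝ) : ℕ∞ :=
  ⨅ (𝒰 : Set (Set X)) (_ : F ⊆ ⋃₀ 𝒰 ∧ ∀ A ∈ 𝒰, Metric.ediam A ≤ ENNReal.ofReal r), 𝒰.encard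

/-- The (upper) box-counting dimension of a set: the infimum of those `s > 0` for which there is
`C > 0` with `N(E, r) ≤ C r⁻ˢ` for all `0 < r < diam E`. -/
def boxDim {X : Type*} [MetricSpace X] (E : Set X) : ℝ≥0∞ :=
  ⨅ (s : ℝ≥0) (_ : 0 < s ∧ ∃ C : ℝ, 0 < C ∧ ∀ r : ℝ, 0 < r → ENNReal.ofReal r < Metric.ediam E →
      (diamCoveringNumber E r : ℝ≥0∞) ≤ ENNReal.ofReal (C * r ^ (-(s : ℝ)))), (s : ℝ≥0∞)

/-- The `θ`-Assouad spectrum (in its upper, or regularized, form): the infimum of those `s > 0` for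
which there is `C > 0` with `N(B(x, R) ∩ E, r) ≤ C (R / r)ˢ` whenever `x ∈ E` and
`0 < r ≤ R ^ (1 / θ) < R < 1`. -/
def assouadSpectrum {X : Type*} [MetricSpace X] (θ : ℝ) (E : Set X) : ℝ≥0∞ :=
  ⨅ (s : ℝ≥0) (_ : 0 < s ∧ ∃ C : ℝ, 0 < C ∧ ∀ x ∈ E, ∀ r R : ℝ,
      0 < r → 0 < R → r ≤ R ^ (1 / θ) → R ^ (1 / θ) < R → R < 1 →
      (diamCoveringNumber (Metric.ball x R ∩ E) r : ℝ≥0∞) ≤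
        ENNReal.ofReal (C * (R / r) ^ (s : ℝ))), (s : ℝ≥0∞)

/-- The (upper) `θ`-intermediate dimension: the infimum of those `s > 0` for which there are
`C, δ₀ > 0` such that for every `δ ∈ (0, δ₀)` the set `E` has a cover by sets `A` with
`δ ^ (1 / θ) ≤ diam A ≤ δ` and `∑ (diam A)ˢ ≤ C`. -/
def intermediateDim {X : Type*} [MetricSpace X] (θ : ℝ) (E : Set X) : ℝ≥0∞ :=
  ⨅ (s : ℝ≥0) (_ : 0 < s ∧ ∃ C : ℝ, 0 < C ∧ ∃ δ₀ : ℝ, 0 < δ₀ ∧ ∀ δ : ℝ, 0 < δ → δ < δ₀ →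
      ∃ 𝒰 : Set (Set X), E ⊆ ⋃₀ 𝒰 ∧
        (∀ A ∈ 𝒰, ENNReal.ofReal (δ ^ (1 / θ)) ≤ Metric.ediam A ∧
          Metric.ediam A ≤ ENNReal.ofReal δ) ∧
        ∑' A : 𝒰, Metric.ediam (A : Set X) ^ (s : ℝ) ≤ ENNReal.ofReal C), (s : ℝ≥0∞)

/-- The quasi-Hausdorff dimension, the limit of the `θ`-intermediate dimensions as `θ ↘ 0`. The
limit exists, see `tendsto_intermediateDim`. -/
def quasiHausdorffDim {X : Type*} [MetricSpace X] (E : Set X) : ℝ≥0∞ :=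
  limUnder (𝓝[>] (0 : ℝ)) (fun θ : ℝ => intermediateDim θ E)

theorem intermediateDim_mono {X : Type*} [MetricSpace X] (E : Set X) {θ θ' : ℝ}
    (hθ : 0 < θ) (h : θ ≤ θ') : intermediateDim θ E ≤ intermediateDim θ' E := by
  refine le_iInf₂ fun s hs => ?_
  obtain ⟨hs0, C, hC, δ₀, hδ₀, H⟩ := hs
  refine iInf₂_le s ⟨hs0, C, hC, min δ₀ 1, lt_min hδ₀ one_pos, fun δ hδ hδ' => ?_⟩
  obtain ⟨𝒰, hcov, hdiam, hsum⟩ := H δ hδ (hδ'.trans_le (min_le_left _ _))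
  refine ⟨𝒰, hcov, fun A hA => ⟨le_trans (ENNReal.ofReal_le_ofReal ?_) (hdiam A hA).1,
    (hdiam A hA).2⟩, hsum⟩
  exact Real.rpow_le_rpow_of_exponent_ge hδ (hδ'.trans_le (min_le_right _ _)).le
    (one_div_le_one_div_of_le hθ h)

theorem tendsto_intermediateDim {X : Type*} [MetricSpace X] (E : Set X) :
    Tendsto (fun θ : ℝ => intermediateDim θ E) (𝓝[>] 0) (𝓝 (quasiHausdorffDim E)) := by
  refine tendsto_nhds_limUnder ⟨sInf ((fun θ : ℝ => intermediateDim θ E) '' Ioi 0), ?_⟩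
  exact MonotoneOn.tendsto_nhdsGT (fun a ha b _ hab => intermediateDim_mono E ha hab)
    (OrderBot.bddBelow _)

/-! ### Quasisymmetric and quasiconformal homeomorphisms -/

/-- A homeomorphism of metric spaces is quasisymmetric if it is `η`-quasisymmetric for some
increasing homeomorphism `η` of `[0, ∞)` (an order isomorphism of `ℝ≥0`). -/
def IsQuasisymmetric {X Y : Type*} [MetricSpace X] [MetricSpace Y] (f : X ≃ₜ Y) : Prop :=
  ∃ η : ℝ≥0 ≃o ℝ≥0, ∀ (x y z : X) (t : ℝ≥0), 0 < t → nndist x y ≤ t * nndist x z →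
    nndist (f x) (f y) ≤ η t * nndist (f x) (f z)

/-- The metric dilatation `H_f(x) = limsup_{r → 0} L_f(x, r) / ℓ_f(x, r)`, where
`L_f(x, r) = sup_{|y - x| = r} |f y - f x|` and `ℓ_f(x, r) = inf_{|y - x| = r} |f y - f x|`. -/
def metricDilatation {X Y : Type*} [MetricSpace X] [MetricSpace Y] (f : X → Y) (x : X) : ℝ≥0∞ :=
  limsup (fun r : ℝ => (⨆ y ∈ Metric.sphere x r, edist (f x) (f y)) /
    (⨅ y ∈ Metric.sphere x r, edist (f x) (f y))) (𝓝[>] 0)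

/-- A homeomorphism of `ℝⁿ` is quasiconformal if its metric dilatation is uniformly bounded. On
the line the bound on the metric dilatation is not enough, and there quasiconformal means
quasisymmetric, as usual. -/
def IsQuasiconformal {n : ℕ} (f : EuclideanSpace ℝ (Fin n) ≃ₜ EuclideanSpace ℝ (Fin n)) : Prop :=
  (∃ H : ℝ≥0, ∀ x, metricDilatation f x ≤ H) ∧ (n = 1 → IsQuasisymmetric f)

/-- The conformal box-counting dimension of a metric space `X`: the infimum of `dim_B Y` over all
metric spaces `Y` quasisymmetrically equivalent to `X`. (Such a `Y` is in bijection with `X`, so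
nothing is lost by taking it in the universe of `X`.) -/
def conformalBoxDim (X : Type) [MetricSpace X] : ℝ≥0∞ :=
  ⨅ (Y : Type) (_ : MetricSpace Y) (f : X ≃ₜ Y) (_ : IsQuasisymmetric f), boxDim (univ : Set Y)

end

/-!
Since `dim_qH E < 1`, there are `s < 1` and `a` such that at every dyadic scale `2⁻ᵏ` the set `E`
has a cover by at most `≲ 2^(a k)` sets of diameter at most `2⁻ᵏ` with `∑ (diam A)ˢ ≲ 1`. Fix
`s < t < β < 1`; a finite measure `ν` built from point masses gives each of these sets `A` at least
the mass `(diam A)ᵗ`. Let `U x r = ∫ (r + |x - y|)^(-β) dν y`, and for a vector `v` let `P_v` be the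
analogous potential of the image of `ν` on the line under `⟪·, v⟫`. As `β < 1`, these
one-dimensional potentials are locally integrable, and their averages over a segment in direction
`v` are, on average over `v`, comparable to `U` at the scale of the segment. Hence the map
`f x = ∫_{|v| ≤ 1} (∫_0^⟪x, v⟫ P_v^(-N)) v dv` satisfies
`⟪f x - f y, x - y⟫ ≈ |f x - f y| |x - y|` and `|f x - f y| ≈ |x - y| U(x, |x - y|)^(-N)`, and so
is a quasisymmetric homeomorphism. On a set `A` of the covers `U` is `≳ (diam A)^(t - β)`, so that
`diam f(A) ≲ (diam A)^(1 + (β - t) N)`. The number of sets in the covers does not depend on `N`,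
and `N → ∞` makes the covering numbers of `f(E)` grow more slowly than any prescribed power.
-/

open MeasureTheory

/-! ### Negative powers of affine functions -/

theorem ennreal_rpow_le_rpow_of_nonpos {a b : ℝ≥0∞} (h : a ≤ b) {z : ℝ} (hz : z ≤ 0) :
    b ^ z ≤ a ^ z := by
  rw [← neg_neg z, ENNReal.rpow_neg b, ENNReal.rpow_neg a]
  exact ENNReal.inv_le_inv.2 (ENNReal.rpow_le_rpow h (neg_nonneg.2 hz))

section NormedSpace

variable {E : Type*} [NormedAddCommGroup E] [NormedSpace ℝ E]

theorem setLIntegral_ball_enorm_rpow_neg_lt_top [FiniteDimensional ℝ E] [MeasurableSpace E]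
    [BorelSpace E] (μ : Measure E) [μ.IsAddHaarMeasure] {β : ℝ} (hβ0 : 0 ≤ β)
    (hβ : β < Module.finrank ℝ E) (r : ℝ) :
    ∫⁻ x in Metric.ball (0 : E) r, ‖x‖ₑ ^ (-β) ∂μ < ⊤ := by
  have hdim : 0 < Module.finrank ℝ E := by exact_mod_cast hβ0.trans_lt hβ
  have : Nontrivial E := Module.nontrivial_of_finrank_pos hdim
  have hmeas : Measurable fun x : E => ‖x‖ ^ (-β) := by fun_prop
  have hint : IntegrableOn (fun x : E => ‖x‖ ^ (-β)) (Metric.ball 0 r) μ :=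
    integrableOn_ball_of_norm_le_rpow (C := 1) hdim hβ
      (Eventually.of_forall fun x => by rw [Real.norm_of_nonneg (by positivity), one_mul])
      hmeas.aestronglyMeasurable
  refine (lintegral_congr_ae ?_).trans_lt hint.2
  filter_upwards [ae_restrict_of_ae (Measure.ae_ne μ 0)] with x hx
  rw [Real.enorm_of_nonneg (by positivity), ← ENNReal.ofReal_rpow_of_pos (norm_pos_iff.2 hx),
    ofReal_norm]

theorem exists_setLIntegral_enorm_add_rpow_neg_le [FiniteDimensional ℝ E] [MeasurableSpace E]
    [BorelSpace E] (μ : Measure E) [μ.IsAddHaarMeasure] {β : ℝ} (hβ0 : 0 ≤ β)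
    (hβ : β < Module.finrank ℝ E) {s : Set E} (hs : μ s ≠ ⊤) :
    ∃ C : ℝ≥0, ∀ x : E, ∫⁻ y in s, ‖x + y‖ₑ ^ (-β) ∂μ ≤ C := by
  set g : E → ℝ≥0∞ := fun y => ‖y‖ₑ ^ (-β)
  have hball : ∫⁻ y in Metric.ball (0 : E) 1, g y ∂μ ≠ ⊤ :=
    (setLIntegral_ball_enorm_rpow_neg_lt_top μ hβ0 hβ 1).ne
  refine ⟨(μ s + ∫⁻ y in Metric.ball (0 : E) 1, g y ∂μ).toNNReal, fun x => ?_⟩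
  rw [ENNReal.coe_toNNReal (ENNReal.add_ne_top.2 ⟨hs, hball⟩)]
  have hsplit : ∀ y, g y ≤ 1 + (Metric.ball (0 : E) 1).indicator g y := by
    intro y
    by_cases hy : y ∈ Metric.ball (0 : E) 1
    · simp [hy]
    · have hy1 : 1 ≤ ‖y‖ₑ := by
        rw [← ofReal_norm, ENNReal.one_le_ofReal]
        simpa using hy
      calc g y ≤ 1 ^ (-β) := ennreal_rpow_le_rpow_of_nonpos hy1 (neg_nonpos.2 hβ0)
        _ ≤ _ := by rw [ENNReal.one_rpow]; exact le_self_add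
  calc ∫⁻ y in s, g (x + y) ∂μ
      ≤ ∫⁻ y in s, (1 + (Metric.ball (0 : E) 1).indicator g (x + y)) ∂μ :=
        lintegral_mono fun y => hsplit (x + y)
    _ = μ s + ∫⁻ y in s, (Metric.ball (0 : E) 1).indicator g (x + y) ∂μ := by
        rw [lintegral_add_left measurable_const, setLIntegral_one]
    _ ≤ μ s + ∫⁻ y, (Metric.ball (0 : E) 1).indicator g (x + y) ∂μ := by
        gcongr; exact Measure.restrict_le_self
    _ = μ s + ∫⁻ y in Metric.ball (0 : E) 1, g y ∂μ := by
        rw [lintegral_add_left_eq_self (fun y => (Metric.ball (0 : E) 1).indicator g y),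
          lintegral_indicator measurableSet_ball]

/-- A segment which is long compared with the distance of its endpoint `p` to the origin is
projected to its own line; a short one stays far from the origin. -/
theorem exists_forall_enorm_add_smul_ge (p q : E) :
    ∃ c : ℝ, ∀ τ ∈ Ioc (0 : ℝ) 1, (‖q‖ₑ + ‖p‖ₑ) * min 1 ‖c + τ‖ₑ ≤ 3 * ‖p + τ • q‖ₑ := by
  suffices ∃ c : ℝ, ∀ τ ∈ Ioc (0 : ℝ) 1, (‖q‖ + ‖p‖) * min 1 |c + τ| ≤ 3 * ‖p + τ • q‖ by
    obtain ⟨c, hc⟩ := this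
    refine ⟨c, fun τ hτ => ?_⟩
    have := ENNReal.ofReal_le_ofReal (hc τ hτ)
    rwa [ENNReal.ofReal_mul (by positivity), ENNReal.ofReal_add (by positivity) (by positivity),
      ENNReal.ofReal_mul (by norm_num), ENNReal.ofReal_min, ofReal_norm, ofReal_norm, ofReal_norm,
      ENNReal.ofReal_one, ENNReal.ofReal_ofNat, ← Real.norm_eq_abs, ofReal_norm] at this
  rcases le_total (2 * ‖q‖) ‖p‖ with h | h
  · refine ⟨0, fun τ hτ => ?_⟩
    have hτq : ‖τ • q‖ ≤ ‖q‖ := by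
      rw [norm_smul, Real.norm_of_nonneg hτ.1.le]
      exact mul_le_of_le_one_left (norm_nonneg q) hτ.2
    have hsub : ‖p‖ ≤ ‖p + τ • q‖ + ‖τ • q‖ := by
      simpa using norm_sub_le (p + τ • q) (τ • q)
    calc (‖q‖ + ‖p‖) * min 1 |0 + τ| ≤ (‖q‖ + ‖p‖) * 1 := by gcongr; exact min_le_left _ _
      _ ≤ 3 * ‖p + τ • q‖ := by linarith
  · obtain ⟨φ, hφ, hφq⟩ := exists_dual_vector'' ℝ q
    refine ⟨φ p / ‖q‖, fun τ _ => ?_⟩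
    rcases eq_or_ne ‖q‖ 0 with hq | hq
    · have hp : ‖p‖ = 0 := by linarith [norm_nonneg p]
      simp [hp, hq]
    calc (‖q‖ + ‖p‖) * min 1 |φ p / ‖q‖ + τ| ≤ 3 * ‖q‖ * |φ p / ‖q‖ + τ| := by
          gcongr
          · linarith
          · exact min_le_right _ _
      _ = 3 * ‖φ (p + τ • q)‖ := by
          have : φ (p + τ • q) = ‖q‖ * (φ p / ‖q‖ + τ) := by
            rw [map_add, map_smul, hφq]
            simp only [RCLike.ofReal_real_eq_id, id_eq, smul_eq_mul]
            field_simp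
          rw [this, norm_mul, norm_norm, Real.norm_eq_abs, mul_assoc]
      _ ≤ 3 * ‖p + τ • q‖ := by
          gcongr
          exact (φ.le_of_opNorm_le hφ _).trans_eq (one_mul _)

theorem exists_lintegral_enorm_add_smul_rpow_neg_le {β : ℝ} (hβ0 : 0 ≤ β) (hβ1 : β < 1) :
    ∃ C : ℝ≥0, ∀ p q : E, ∫⁻ τ in Ioc (0 : ℝ) 1, ‖p + τ • q‖ₑ ^ (-β) ≤
      C * (‖q‖ₑ + ‖p‖ₑ) ^ (-β) := by
  obtain ⟨D, hD⟩ := exists_setLIntegral_enorm_add_rpow_neg_le (volume : Measure ℝ) hβ0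
    (by simpa using hβ1) (s := Ioc 0 1) (by simp)
  refine ⟨3 ^ β * (1 + D), fun p q => ?_⟩
  obtain ⟨c, hc⟩ := exists_forall_enorm_add_smul_ge p q
  have hpointwise : ∀ τ ∈ Ioc (0 : ℝ) 1, ‖p + τ • q‖ₑ ^ (-β) ≤
      3 ^ β * (‖q‖ₑ + ‖p‖ₑ) ^ (-β) * (1 + ‖c + τ‖ₑ ^ (-β)) := by
    intro τ hτ
    have hmin : min 1 ‖c + τ‖ₑ ^ (-β) ≤ 1 + ‖c + τ‖ₑ ^ (-β) := by
      rcases min_choice 1 ‖c + τ‖ₑ with h | h <;> rw [h]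
      · rw [ENNReal.one_rpow]; exact le_self_add
      · exact le_add_self
    calc ‖p + τ • q‖ₑ ^ (-β) = 3 ^ β * (3 * ‖p + τ • q‖ₑ) ^ (-β) := by
          rw [ENNReal.mul_rpow_of_ne_top (by simp) (by simp), ← mul_assoc,
            ← ENNReal.rpow_add _ _ (by simp) (by simp), add_neg_cancel, ENNReal.rpow_zero, one_mul]
      _ ≤ 3 ^ β * ((‖q‖ₑ + ‖p‖ₑ) * min 1 ‖c + τ‖ₑ) ^ (-β) := by
          exact mul_le_mul_right (ennreal_rpow_le_rpow_of_nonpos (hc τ hτ) (neg_nonpos.2 hβ0)) _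
      _ = 3 ^ β * (‖q‖ₑ + ‖p‖ₑ) ^ (-β) * min 1 ‖c + τ‖ₑ ^ (-β) := by
          rw [ENNReal.mul_rpow_of_ne_top (by simp) (by simp), mul_assoc]
      _ ≤ _ := by gcongr
  calc ∫⁻ τ in Ioc (0 : ℝ) 1, ‖p + τ • q‖ₑ ^ (-β)
      ≤ ∫⁻ τ in Ioc (0 : ℝ) 1, 3 ^ β * (‖q‖ₑ + ‖p‖ₑ) ^ (-β) * (1 + ‖c + τ‖ₑ ^ (-β)) :=
        setLIntegral_mono (by fun_prop) hpointwise
    _ = 3 ^ β * (‖q‖ₑ + ‖p‖ₑ) ^ (-β) * (1 + ∫⁻ τ in Ioc (0 : ℝ) 1, ‖c + τ‖ₑ ^ (-β)) := by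
        rw [lintegral_const_mul _ (by fun_prop), lintegral_add_left measurable_const]
        simp
    _ ≤ 3 ^ β * (‖q‖ₑ + ‖p‖ₑ) ^ (-β) * (1 + D) := by gcongr; exact hD c
    _ = (3 ^ β * (1 + D) : ℝ≥0) * (‖q‖ₑ + ‖p‖ₑ) ^ (-β) := by
        push_cast [ENNReal.coe_rpow_of_nonneg _ hβ0]
        ring

end NormedSpace

section InnerProductSpace

variable {H : Type*} [NormedAddCommGroup H] [InnerProductSpace ℝ H] [FiniteDimensional ℝ H]
  [MeasurableSpace H] [BorelSpace H]

/-- Averaging over the translates of the ball in the direction `e` reduces this to dimension one. -/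
theorem exists_setLIntegral_closedBall_enorm_inner_rpow_neg_le_of_norm_eq_one {β : ℝ} (hβ0 : 0 ≤ β)
    (hβ1 : β < 1) : ∃ C : ℝ≥0, ∀ e : H, ‖e‖ = 1 →
      ∫⁻ v in Metric.closedBall (0 : H) 1, ‖inner ℝ e v‖ₑ ^ (-β) ≤ C := by
  obtain ⟨D, hD⟩ := exists_setLIntegral_enorm_add_rpow_neg_le (volume : Measure ℝ) hβ0
    (by simpa using hβ1) (s := Ioc 0 1) (by simp)
  refine ⟨D * (volume (Metric.closedBall (0 : H) 2)).toNNReal, fun e he => ?_⟩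
  set g : ℝ → ℝ≥0∞ := fun t => ‖t‖ₑ ^ (-β)
  have hg : Measurable g := by fun_prop
  have hshift : ∀ τ ∈ Ioc (0 : ℝ) 1, ∫⁻ v in Metric.closedBall (0 : H) 1, g (inner ℝ e v) ≤
      ∫⁻ v in Metric.closedBall (0 : H) 2, g (inner ℝ e v + τ) := by
    intro τ hτ
    rw [← lintegral_indicator measurableSet_closedBall,
      ← lintegral_indicator measurableSet_closedBall, ← lintegral_add_right_eq_self _ (τ • e)]
    refine lintegral_mono fun v => indicator_apply_le' (fun hv => ?_) fun _ => zero_le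
    have hv2 : v ∈ Metric.closedBall (0 : H) 2 := by
      rw [mem_closedBall_zero_iff] at hv ⊢
      have hτe : ‖τ • e‖ ≤ 1 := by
        rw [norm_smul, he, Real.norm_of_nonneg hτ.1.le, mul_one]; exact hτ.2
      have htriangle : ‖v‖ ≤ ‖v + τ • e‖ + ‖τ • e‖ := by
        simpa using norm_sub_le (v + τ • e) (τ • e)
      linarith
    rw [indicator_of_mem hv2, inner_add_right, real_inner_smul_right, real_inner_self_eq_norm_sq,
      he, one_pow, mul_one]
  calc ∫⁻ v in Metric.closedBall (0 : H) 1, g (inner ℝ e v)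
      = ∫⁻ _τ in Ioc (0 : ℝ) 1, ∫⁻ v in Metric.closedBall (0 : H) 1, g (inner ℝ e v) := by simp
    _ ≤ ∫⁻ τ in Ioc (0 : ℝ) 1, ∫⁻ v in Metric.closedBall (0 : H) 2, g (inner ℝ e v + τ) :=
        setLIntegral_mono' measurableSet_Ioc hshift
    _ = ∫⁻ v in Metric.closedBall (0 : H) 2, ∫⁻ τ in Ioc (0 : ℝ) 1, g (inner ℝ e v + τ) :=
        lintegral_lintegral_swap (hg.comp (by fun_prop)).aemeasurable
    _ ≤ ∫⁻ _v in Metric.closedBall (0 : H) 2, D := lintegral_mono fun v => hD _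
    _ = (D * (volume (Metric.closedBall (0 : H) 2)).toNNReal : ℝ≥0) := by
        rw [setLIntegral_const, ENNReal.coe_mul, ENNReal.coe_toNNReal measure_closedBall_lt_top.ne]

theorem exists_setLIntegral_closedBall_enorm_inner_rpow_neg_le {β : ℝ} (hβ0 : 0 < β)
    (hβ1 : β < 1) : ∃ C : ℝ≥0, ∀ p : H,
      ∫⁻ v in Metric.closedBall (0 : H) 1, ‖inner ℝ p v‖ₑ ^ (-β) ≤ C * ‖p‖ₑ ^ (-β) := by
  obtain ⟨C, hC⟩ := exists_setLIntegral_closedBall_enorm_inner_rpow_neg_le_of_norm_eq_one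
    (H := H) hβ0.le hβ1
  refine ⟨C + 1, fun p => ?_⟩
  rcases eq_or_ne p 0 with rfl | hp
  · simp [hβ0, ENNReal.mul_top]
  have hp' : ‖p‖ ≠ 0 := norm_ne_zero_iff.2 hp
  have hunit : ‖‖p‖⁻¹ • p‖ = 1 := norm_smul_inv_norm hp
  have hscale : ∀ v, ‖inner ℝ p v‖ₑ = ‖p‖ₑ * ‖inner ℝ (‖p‖⁻¹ • p) v‖ₑ := fun v => by
    rw [← enorm_norm p, ← enorm_mul, real_inner_smul_left, mul_inv_cancel_left₀ hp']
  calc ∫⁻ v in Metric.closedBall (0 : H) 1, ‖inner ℝ p v‖ₑ ^ (-β)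
      = ∫⁻ v in Metric.closedBall (0 : H) 1,
          ‖p‖ₑ ^ (-β) * ‖inner ℝ (‖p‖⁻¹ • p) v‖ₑ ^ (-β) := by
        refine lintegral_congr fun v => ?_
        rw [hscale, ENNReal.mul_rpow_of_ne_top (by simp) (by simp)]
    _ = ‖p‖ₑ ^ (-β) * ∫⁻ v in Metric.closedBall (0 : H) 1,
          ‖inner ℝ (‖p‖⁻¹ • p) v‖ₑ ^ (-β) := by
        rw [lintegral_const_mul _ (by fun_prop)]
    _ ≤ (C + 1 : ℝ≥0) * ‖p‖ₑ ^ (-β) := by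
        rw [mul_comm]
        gcongr
        exact (hC _ hunit).trans (by simp)

theorem exists_le_setLIntegral_closedBall_inner_sq : ∃ m : ℝ≥0, m ≠ 0 ∧ ∀ q : H,
    m * ‖q‖ₑ ^ 2 ≤ ∫⁻ v in Metric.closedBall (0 : H) 1, ‖inner ℝ q v‖ₑ ^ 2 := by
  have hfin : volume (Metric.ball (0 : H) (1 / 4)) ≠ ⊤ := measure_ball_lt_top.ne
  have hpos : volume (Metric.ball (0 : H) (1 / 4)) ≠ 0 :=
    (Metric.measure_ball_pos _ _ (by norm_num)).ne'
  refine ⟨(1 / 4) ^ 2 * (volume (Metric.ball (0 : H) (1 / 4))).toNNReal,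
    mul_ne_zero (by norm_num) (ENNReal.toNNReal_ne_zero.2 ⟨hpos, hfin⟩), fun q => ?_⟩
  rcases eq_or_ne q 0 with rfl | hq
  · simp
  set e := ‖q‖⁻¹ • q
  have he : ‖e‖ = 1 := norm_smul_inv_norm hq
  have hball : Metric.ball ((1 / 2 : ℝ) • e) (1 / 4) ⊆ Metric.closedBall 0 1 := by
    refine Metric.ball_subset_closedBall.trans (Metric.closedBall_subset_closedBall' ?_)
    rw [dist_zero_right, norm_smul, he]
    norm_num
  have hinner : ∀ v ∈ Metric.ball ((1 / 2 : ℝ) • e) (1 / 4), 1 / 4 * ‖q‖ₑ ≤ ‖inner ℝ q v‖ₑ := by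
    intro v hv
    have hsub : |inner ℝ q (v - (1 / 2 : ℝ) • e)| ≤ ‖q‖ * (1 / 4) :=
      (abs_real_inner_le_norm _ _).trans (by gcongr; exact (mem_ball_iff_norm.1 hv).le)
    have hqe : inner ℝ q ((1 / 2 : ℝ) • e) = 1 / 2 * ‖q‖ := by
      rw [real_inner_smul_right, real_inner_smul_right, real_inner_self_eq_norm_sq]
      field_simp
    have hle : 1 / 4 * ‖q‖ ≤ ‖inner ℝ q v‖ := by
      rw [inner_sub_right, hqe, abs_le] at hsub
      rw [Real.norm_eq_abs]
      linarith [le_abs_self (inner ℝ q v), hsub.1]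
    have := ENNReal.ofReal_le_ofReal hle
    rwa [ENNReal.ofReal_mul (by norm_num), ofReal_norm, ofReal_norm,
      ENNReal.ofReal_div_of_pos (by norm_num), ENNReal.ofReal_one, ENNReal.ofReal_ofNat] at this
  calc _ = ∫⁻ v in Metric.ball ((1 / 2 : ℝ) • e) (1 / 4), (1 / 4 * ‖q‖ₑ) ^ 2 := by
        rw [setLIntegral_const, Measure.addHaar_ball_center _ (_ • _), ENNReal.coe_mul,
          ENNReal.coe_toNNReal hfin, mul_pow]
        push_cast
        ring
    _ ≤ ∫⁻ v in Metric.ball ((1 / 2 : ℝ) • e) (1 / 4), ‖inner ℝ q v‖ₑ ^ 2 :=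
        setLIntegral_mono' measurableSet_ball fun v hv => by gcongr; exact hinner v hv
    _ ≤ _ := lintegral_mono_set hball

end InnerProductSpace

/-! ### Riesz potentials -/

theorem lintegral_rpow_add_one_le {α : Type*} [MeasurableSpace α] {μ : Measure α}
    {f g : α → ℝ≥0∞} (hf : AEMeasurable f μ) (hg : AEMeasurable g μ) (hg0 : ∀ᵐ a ∂μ, g a ≠ 0)
    (hg_top : ∀ᵐ a ∂μ, g a ≠ ⊤) {N : ℝ} (hN : 0 ≤ N) :
    (∫⁻ a, f a ∂μ) ^ (N + 1) ≤ (∫⁻ a, f a * g a ∂μ) ^ N * ∫⁻ a, f a * g a ^ (-N) ∂μ := by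
  have hN1 : 0 < N + 1 := by positivity
  have hexp : N / (N + 1) + 1 / (N + 1) = 1 := by field_simp
  have hfactor : ∫⁻ a, f a ∂μ =
      ∫⁻ a, (f a * g a) ^ (N / (N + 1)) * (f a * g a ^ (-N)) ^ (1 / (N + 1)) ∂μ := by
    refine lintegral_congr_ae ?_
    filter_upwards [hg0, hg_top] with a h0 htop
    have hcancel : N / (N + 1) + -N * (1 / (N + 1)) = 0 := by ring
    rw [ENNReal.mul_rpow_of_nonneg _ _ (by positivity),
      ENNReal.mul_rpow_of_nonneg _ _ (by positivity), mul_mul_mul_comm, ← ENNReal.rpow_mul,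
      ← ENNReal.rpow_add_of_nonneg _ _ (by positivity) (by positivity), hexp, ENNReal.rpow_one,
      ← ENNReal.rpow_add _ _ h0 htop, hcancel, ENNReal.rpow_zero, mul_one]
  calc (∫⁻ a, f a ∂μ) ^ (N + 1)
      ≤ ((∫⁻ a, f a * g a ∂μ) ^ (N / (N + 1)) *
          (∫⁻ a, f a * g a ^ (-N) ∂μ) ^ (1 / (N + 1))) ^ (N + 1) := by
        rw [hfactor]
        gcongr
        exact ENNReal.lintegral_mul_norm_pow_le (hf.mul hg) (hf.mul (hg.pow_const _))
          (by positivity) (by positivity) hexp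
    _ = (∫⁻ a, f a * g a ∂μ) ^ N * ∫⁻ a, f a * g a ^ (-N) ∂μ := by
        rw [ENNReal.mul_rpow_of_nonneg _ _ hN1.le, ← ENNReal.rpow_mul, ← ENNReal.rpow_mul,
          div_mul_cancel₀ _ hN1.ne', div_mul_cancel₀ _ hN1.ne', ENNReal.rpow_one]

theorem mul_rpow_neg_le_of_rpow_add_one_le {a c j m u : ℝ≥0∞} {N : ℝ} (hN : 0 ≤ N) (ha0 : a ≠ 0)
    (ha : a ≠ ⊤) (hm0 : m ≠ 0) (hm : m ≠ ⊤) (hu0 : u ≠ 0) (hu : u ≠ ⊤)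
    (h : (m * a) ^ (N + 1) ≤ (a * (c * u)) ^ N * j) :
    a * u ^ (-N) ≤ m ^ (-(N + 1)) * c ^ N * j := by
  have hau0 : a * u ≠ 0 := mul_ne_zero ha0 hu0
  have hau : a * u ≠ ⊤ := ENNReal.mul_ne_top ha hu
  calc a * u ^ (-N) = m ^ (-(N + 1)) * (m * a) ^ (N + 1) * (a * u) ^ (-N) := by
        rw [ENNReal.mul_rpow_of_nonneg _ _ (by positivity), ENNReal.mul_rpow_of_ne_top ha hu,
          ← mul_assoc, ← mul_assoc, ← ENNReal.rpow_add _ _ hm0 hm, neg_add_cancel,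
          ENNReal.rpow_zero, one_mul, ← ENNReal.rpow_add _ _ ha0 ha, add_comm N,
          add_neg_cancel_right, ENNReal.rpow_one]
    _ ≤ m ^ (-(N + 1)) * ((a * (c * u)) ^ N * j) * (a * u) ^ (-N) := by gcongr
    _ = m ^ (-(N + 1)) * c ^ N * j * ((a * u) ^ N * (a * u) ^ (-N)) := by
        rw [mul_left_comm a, ENNReal.mul_rpow_of_nonneg _ _ hN]
        ring
    _ = m ^ (-(N + 1)) * c ^ N * j := by
        rw [← ENNReal.rpow_add _ _ hau0 hau, add_neg_cancel, ENNReal.rpow_zero, mul_one]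

/-- The Riesz potential of order `β` of `ν`, smoothed at scale `r`: it controls the average over a
segment of length `r` starting at `x` of the potential `∫ |x - y|^(-β) dν(y)`. -/
noncomputable def rieszPotential {X : Type*} [PseudoEMetricSpace X] [MeasurableSpace X]
    (ν : Measure X) (β : ℝ) (x : X) (r : ℝ≥0∞) : ℝ≥0∞ :=
  ∫⁻ y, (r + edist x y) ^ (-β) ∂ν

section RieszPotential

variable {X : Type*} [MeasurableSpace X] {β : ℝ} {r : ℝ≥0∞}

theorem rieszPotential_le_rpow_mul [PseudoEMetricSpace X] (ν : Measure X) (hβ : 0 ≤ β) (x : X)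
    {R t : ℝ≥0∞} (ht1 : 1 ≤ t) (ht : t ≠ ⊤) (hr : r ≤ t * R) :
    rieszPotential ν β x R ≤ t ^ β * rieszPotential ν β x r := by
  have ht0 : t ≠ 0 := (one_pos.trans_le ht1).ne'
  have htβ : t ^ β ≠ ⊤ := ENNReal.rpow_ne_top_of_nonneg hβ ht
  have hpointwise : ∀ y, (R + edist x y) ^ (-β) ≤ t ^ β * (r + edist x y) ^ (-β) := fun y =>
    calc (R + edist x y) ^ (-β) = t ^ β * (t * (R + edist x y)) ^ (-β) := by
          rw [ENNReal.mul_rpow_eq_ite, if_neg (by simp [ht0, ht]), ← mul_assoc,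
            ← ENNReal.rpow_add _ _ ht0 ht, add_neg_cancel, ENNReal.rpow_zero, one_mul]
      _ ≤ t ^ β * (r + edist x y) ^ (-β) := by
          refine mul_le_mul_right (ennreal_rpow_le_rpow_of_nonpos ?_ (neg_nonpos.2 hβ)) _
          rw [mul_add]
          exact add_le_add hr (le_mul_of_one_le_left zero_le ht1)
  rw [rieszPotential, rieszPotential, ← lintegral_const_mul' _ _ htβ]
  exact lintegral_mono hpointwise

theorem rieszPotential_anti [PseudoEMetricSpace X] (ν : Measure X) (hβ : 0 ≤ β) (x : X) :
    Antitone (rieszPotential ν β x) := fun r R hrR => by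
  simpa using rieszPotential_le_rpow_mul ν hβ x le_rfl ENNReal.one_ne_top (by rwa [one_mul])

theorem rieszPotential_ne_top [PseudoEMetricSpace X] (ν : Measure X) [IsFiniteMeasure ν]
    (hβ : 0 ≤ β) (x : X) (hr : r ≠ 0) : rieszPotential ν β x r ≠ ⊤ := by
  have hpointwise : ∀ y, (r + edist x y) ^ (-β) ≤ r ^ (-β) := fun y =>
    ennreal_rpow_le_rpow_of_nonpos le_self_add (neg_nonpos.2 hβ)
  refine ((lintegral_mono hpointwise).trans_lt ?_).ne
  rw [lintegral_const]
  refine ENNReal.mul_lt_top ?_ (measure_lt_top ν univ)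
  rw [ENNReal.rpow_neg, ENNReal.inv_lt_top]
  exact ENNReal.rpow_pos_of_nonneg (pos_iff_ne_zero.2 hr) hβ

theorem rieszPotential_ne_zero [PseudoMetricSpace X] [OpensMeasurableSpace X] (ν : Measure X)
    [NeZero ν] (hβ : 0 ≤ β) (x : X) (hr : r ≠ ⊤) : rieszPotential ν β x r ≠ 0 := by
  have hmeas : Measurable fun y => (r + edist x y) ^ (-β) :=
    (measurable_edist_right.const_add r).pow_const _
  rw [rieszPotential, Ne, lintegral_eq_zero_iff hmeas]
  intro hzero
  obtain ⟨y, hy⟩ := hzero.exists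
  simp only [Pi.zero_apply, ENNReal.rpow_neg, ENNReal.inv_eq_zero] at hy
  exact ENNReal.rpow_ne_top_of_nonneg hβ (ENNReal.add_ne_top.2 ⟨hr, edist_ne_top x y⟩) hy

theorem rpow_mul_measure_le_rieszPotential [PseudoEMetricSpace X] [OpensMeasurableSpace X]
    (ν : Measure X) (hβ : 0 ≤ β) {x : X} {A : Set X} {s : ℝ≥0∞} (hA : ∀ y ∈ A, edist x y ≤ s) :
    (r + s) ^ (-β) * ν A ≤ rieszPotential ν β x r := by
  have hmeas : Measurable fun y => (r + edist x y) ^ (-β) :=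
    (measurable_edist_right.const_add r).pow_const _
  calc (r + s) ^ (-β) * ν A = ∫⁻ _y in A, (r + s) ^ (-β) ∂ν := (setLIntegral_const _ _).symm
    _ ≤ ∫⁻ y in A, (r + edist x y) ^ (-β) ∂ν := by
        refine setLIntegral_mono hmeas fun y hy => ?_
        exact ennreal_rpow_le_rpow_of_nonpos (add_le_add_right (hA y hy) r) (neg_nonpos.2 hβ)
    _ ≤ rieszPotential ν β x r := setLIntegral_le_lintegral _ _

end RieszPotential

/-! ### Maps built from slab weights -/

section SlabMap

variable {H : Type*} [NormedAddCommGroup H]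

/-- A slab weight assigns a density on the line to each direction `v` of the unit ball, that is, a
density on the slabs orthogonal to `v`. -/
structure IsSlabWeight [MeasurableSpace H] (w : H → ℝ → ℝ≥0) : Prop where
  measurable : Measurable fun p : H × ℝ => w p.1 p.2
  exists_forall_le : ∀ R : ℝ, ∃ M : ℝ≥0, ∀ v t, ‖v‖ ≤ 1 → |t| ≤ R → w v t ≤ M

theorem IsSlabWeight.intervalIntegrable [MeasurableSpace H] {w : H → ℝ → ℝ≥0} (hw : IsSlabWeight w)
    {v : H} (hv : ‖v‖ ≤ 1) (a b : ℝ) :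
    IntervalIntegrable (fun t => (w v t : ℝ)) volume a b := by
  obtain ⟨M, hM⟩ := hw.exists_forall_le (max |min a b| |max a b|)
  have hmeas : Measurable fun t => (w v t : ℝ) :=
    (hw.measurable.comp measurable_prodMk_left).coe_nnreal_real
  rw [intervalIntegrable_iff]
  refine Measure.integrableOn_of_bounded (M := M) (by simp [uIoc]) hmeas.aestronglyMeasurable ?_
  filter_upwards [ae_restrict_mem measurableSet_uIoc] with t ht
  rw [NNReal.norm_eq]
  exact_mod_cast hM v t hv (abs_le_max_abs_abs ht.1.le ht.2)

variable [InnerProductSpace ℝ H]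

theorem abs_inner_add_smul_sub_sub_inner_le (x y : H) {v : H} (hv : ‖v‖ ≤ 1) {τ : ℝ}
    (hτ : τ ∈ Ioc (0 : ℝ) 1) : |inner ℝ (x + τ • (y - x)) v - inner ℝ x v| ≤ ‖y - x‖ := by
  calc |inner ℝ (x + τ • (y - x)) v - inner ℝ x v| = |inner ℝ (τ • (y - x)) v| := by
        rw [← inner_sub_left, add_sub_cancel_left]
    _ ≤ ‖τ • (y - x)‖ * ‖v‖ := abs_real_inner_le_norm _ _
    _ ≤ ‖τ • (y - x)‖ * 1 := by gcongr
    _ ≤ ‖y - x‖ := by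
        rw [mul_one, norm_smul, Real.norm_of_nonneg hτ.1.le]
        exact mul_le_of_le_one_left (norm_nonneg _) hτ.2

/-- The integrand which represents the increment of `slabMap w` along the segment from `x` to
`y`. -/
noncomputable def slabIncrement (w : H → ℝ → ℝ≥0) (x y : H) (p : H × ℝ) : H :=
  (inner ℝ (y - x) p.1 * w p.1 (inner ℝ (x + p.2 • (y - x)) p.1)) • p.1

theorem norm_slabIncrement_le {w : H → ℝ → ℝ≥0} {x y : H} {p : H × ℝ} (hp : ‖p.1‖ ≤ 1) {M : ℝ≥0}
    (hM : w p.1 (inner ℝ (x + p.2 • (y - x)) p.1) ≤ M) :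
    ‖slabIncrement w x y p‖ ≤ ‖y - x‖ * M := by
  have hinner : ‖inner ℝ (y - x) p.1‖ ≤ ‖y - x‖ :=
    (norm_inner_le_norm _ _).trans (mul_le_of_le_one_right (norm_nonneg _) hp)
  rw [slabIncrement, norm_smul, norm_mul, NNReal.norm_eq]
  exact mul_le_of_le_one_right (by positivity) hp |>.trans (by gcongr)

theorem IsSlabWeight.integral_inner_sub_integral_inner [MeasurableSpace H] {w : H → ℝ → ℝ≥0}
    (hw : IsSlabWeight w) (x y : H) {v : H} (hv : ‖v‖ ≤ 1) :
    (∫ s in (0 : ℝ)..inner ℝ y v, (w v s : ℝ)) - ∫ s in (0 : ℝ)..inner ℝ x v, (w v s : ℝ) =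
      ∫ τ in Ioc (0 : ℝ) 1, inner ℝ (y - x) v * w v (inner ℝ (x + τ • (y - x)) v) := by
  have hparam : ∀ τ : ℝ, inner ℝ (x + τ • (y - x)) v = inner ℝ (y - x) v * τ + inner ℝ x v :=
    fun τ => by rw [inner_add_left, real_inner_smul_left]; ring
  have hend : inner ℝ (y - x) v * 1 + inner ℝ x v = inner ℝ y v := by
    rw [inner_sub_left]; ring
  rw [intervalIntegral.integral_interval_sub_left (hw.intervalIntegrable hv _ _)
    (hw.intervalIntegrable hv _ _), integral_const_mul,
    ← intervalIntegral.integral_of_le zero_le_one]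
  simp only [hparam]
  rw [intervalIntegral.mul_integral_comp_mul_add (f := fun s => (w v s : ℝ)), hend, mul_zero,
    zero_add]

variable [FiniteDimensional ℝ H] [MeasurableSpace H] [BorelSpace H]

/-- The superposition over the directions `v` of the unit ball of the maps `x ↦ g_v(⟪x, v⟫) v`,
where `g_v` is the primitive of the slab weight `w v`. Each of them is the gradient of a convex
function of `⟪x, v⟫`. -/
noncomputable def slabMap (w : H → ℝ → ℝ≥0) (x : H) : H :=
  ∫ v in Metric.closedBall (0 : H) 1, (∫ s in (0 : ℝ)..inner ℝ x v, (w v s : ℝ)) • v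

/-- The product of the Lebesgue measures on the unit ball, whose points are directions, and on the
unit interval, which parametrizes a segment. -/
noncomputable abbrev ballSegment (H : Type*) [NormedAddCommGroup H] [InnerProductSpace ℝ H]
    [FiniteDimensional ℝ H] [MeasurableSpace H] [BorelSpace H] : Measure (H × ℝ) :=
  (volume.restrict (Metric.closedBall (0 : H) 1)).prod (volume.restrict (Ioc (0 : ℝ) 1))

instance isFiniteMeasure_volume_restrict_closedBall (x : H) (r : ℝ) :
    IsFiniteMeasure (volume.restrict (Metric.closedBall x r)) :=
  isFiniteMeasure_restrict.2 measure_closedBall_lt_top.ne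

theorem ae_ballSegment : ∀ᵐ p ∂(ballSegment H), ‖p.1‖ ≤ 1 ∧ p.2 ∈ Ioc (0 : ℝ) 1 := by
  rw [ballSegment, Measure.prod_restrict]
  filter_upwards [ae_restrict_mem (measurableSet_closedBall.prod measurableSet_Ioc)] with p hp
  exact ⟨mem_closedBall_zero_iff.1 hp.1, hp.2⟩

variable {w : H → ℝ → ℝ≥0}

namespace IsSlabWeight

theorem integrable_slabIncrement (hw : IsSlabWeight w) (x y : H) :
    Integrable (slabIncrement w x y) (ballSegment H) := by
  obtain ⟨M, hM⟩ := hw.exists_forall_le (‖x‖ + ‖y - x‖)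
  have hmeas : Measurable fun p : H × ℝ => (w p.1 (inner ℝ (x + p.2 • (y - x)) p.1) : ℝ) :=
    (hw.measurable.comp (f := fun p : H × ℝ => (p.1, inner ℝ (x + p.2 • (y - x)) p.1))
      (by fun_prop)).coe_nnreal_real
  refine Integrable.of_bound (C := ‖y - x‖ * M) ?_ ?_
  · exact Measurable.aestronglyMeasurable (by unfold slabIncrement; fun_prop)
  · filter_upwards [ae_ballSegment] with p hp
    refine norm_slabIncrement_le hp.1 (hM _ _ hp.1 ?_)
    have hx : |inner ℝ x p.1| ≤ ‖x‖ :=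
      (abs_real_inner_le_norm _ _).trans (mul_le_of_le_one_right (norm_nonneg _) hp.1)
    have hsub := abs_inner_add_smul_sub_sub_inner_le x y hp.1 hp.2
    linarith [abs_sub_abs_le_abs_sub (inner ℝ (x + p.2 • (y - x)) p.1) (inner ℝ x p.1)]

theorem integrableOn_integral_smul (hw : IsSlabWeight w) (x : H) :
    IntegrableOn (fun v => (∫ s in (0 : ℝ)..inner ℝ x v, (w v s : ℝ)) • v)
      (Metric.closedBall (0 : H) 1) := by
  refine (hw.integrable_slabIncrement 0 x).integral_prod_left.congr ?_
  filter_upwards [ae_restrict_mem measurableSet_closedBall] with v hv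
  have h := hw.integral_inner_sub_integral_inner 0 x (mem_closedBall_zero_iff.1 hv)
  rw [inner_zero_left, intervalIntegral.integral_same, sub_zero] at h
  rw [h]
  exact integral_smul_const _ v

theorem slabMap_sub_slabMap (hw : IsSlabWeight w) (x y : H) :
    slabMap w y - slabMap w x = ∫ p, slabIncrement w x y p ∂(ballSegment H) := by
  rw [slabMap, slabMap, ← integral_sub (hw.integrableOn_integral_smul y)
    (hw.integrableOn_integral_smul x), integral_prod _ (hw.integrable_slabIncrement x y)]
  refine setIntegral_congr_fun measurableSet_closedBall fun v hv => ?_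
  simp only [slabIncrement]
  rw [← sub_smul, hw.integral_inner_sub_integral_inner x y (mem_closedBall_zero_iff.1 hv),
    integral_smul_const]

theorem edist_slabMap_le (hw : IsSlabWeight w) {x y : H} {M : ℝ≥0}
    (hM : ∀ v t, ‖v‖ ≤ 1 → |t - inner ℝ x v| ≤ ‖y - x‖ → w v t ≤ M) :
    edist (slabMap w x) (slabMap w y) ≤ ballSegment H univ * (edist x y * M) := by
  have hbound : ∀ᵐ p ∂(ballSegment H), ‖slabIncrement w x y p‖ ≤ ‖y - x‖ * M := by
    filter_upwards [ae_ballSegment] with p hp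
    exact norm_slabIncrement_le hp.1
      (hM _ _ hp.1 (abs_inner_add_smul_sub_sub_inner_le x y hp.1 hp.2))
  have hnorm := ENNReal.ofReal_le_ofReal (norm_integral_le_of_norm_le_const hbound)
  rw [← hw.slabMap_sub_slabMap, ofReal_norm, ENNReal.ofReal_mul (by positivity),
    ENNReal.ofReal_mul (by positivity), ofReal_norm, ENNReal.ofReal_coe_nnreal,
    ofReal_measureReal, mul_comm] at hnorm
  rwa [edist_comm, edist_comm x, edist_eq_enorm_sub, edist_eq_enorm_sub]

theorem ofReal_inner_slabMap_sub (hw : IsSlabWeight w) (x y : H) :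
    ENNReal.ofReal (inner ℝ (slabMap w y - slabMap w x) (y - x)) =
      ∫⁻ p, ‖inner ℝ (y - x) p.1‖ₑ ^ 2 * w p.1 (inner ℝ (x + p.2 • (y - x)) p.1)
        ∂(ballSegment H) := by
  have hinner : ∀ p, inner ℝ (y - x) (slabIncrement w x y p) =
      inner ℝ (y - x) p.1 ^ 2 * w p.1 (inner ℝ (x + p.2 • (y - x)) p.1) := fun p => by
    rw [slabIncrement, real_inner_smul_right]; ring
  have hint := hw.integrable_slabIncrement x y
  rw [hw.slabMap_sub_slabMap, real_inner_comm, ← integral_inner hint,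
    ofReal_integral_eq_lintegral_ofReal (hint.const_inner (y - x))]
  · refine lintegral_congr fun p => ?_
    rw [hinner, ENNReal.ofReal_mul (sq_nonneg _), ENNReal.ofReal_coe_nnreal, ← sq_abs,
      ENNReal.ofReal_pow (abs_nonneg _), ← Real.norm_eq_abs, ofReal_norm]
  · exact Eventually.of_forall fun p => by simp only [Pi.zero_apply, hinner]; positivity

end IsSlabWeight

end SlabMap

/-! ### The map of a Riesz potential -/

section RieszMap

variable {H : Type*} [NormedAddCommGroup H] [InnerProductSpace ℝ H] [MeasurableSpace H]

/-- The Riesz potential at `t` of the projection of `ν` to the line by `y ↦ ⟪y, v⟫`. -/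
noncomputable def slabPotential (ν : Measure H) (β : ℝ) (v : H) (t : ℝ) : ℝ≥0∞ :=
  ∫⁻ y, ‖t - inner ℝ y v‖ₑ ^ (-β) ∂ν

/-- The slab weight whose density is the power `-N` of the slab potential. -/
noncomputable def slabWeight (ν : Measure H) (β N : ℝ) (v : H) (t : ℝ) : ℝ≥0 :=
  (slabPotential ν β v t ^ (-N)).toNNReal

section SlabWeight

variable (ν : Measure H) {β N : ℝ} {v : H}

theorem rieszPotential_le_slabPotential (hβ : 0 ≤ β) (hv : ‖v‖ ≤ 1) {x : H} {t : ℝ} {r : ℝ≥0∞}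
    (ht : ‖t - inner ℝ x v‖ₑ ≤ r) : rieszPotential ν β x r ≤ slabPotential ν β v t := by
  refine lintegral_mono fun y => ennreal_rpow_le_rpow_of_nonpos ?_ (neg_nonpos.2 hβ)
  have hxy : ‖inner ℝ (x - y) v‖ₑ ≤ edist x y := by
    rw [edist_eq_enorm_sub]
    exact enorm_le_iff_norm_le.2
      ((norm_inner_le_norm _ _).trans (mul_le_of_le_one_right (norm_nonneg _) hv))
  calc ‖t - inner ℝ y v‖ₑ = ‖t - inner ℝ x v + inner ℝ (x - y) v‖ₑ := by
        rw [inner_sub_left, sub_add_sub_cancel]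
    _ ≤ ‖t - inner ℝ x v‖ₑ + ‖inner ℝ (x - y) v‖ₑ := enorm_add_le _ _
    _ ≤ r + edist x y := add_le_add ht hxy

theorem measurable_slabPotential [OpensMeasurableSpace H] [SecondCountableTopology H]
    [SFinite ν] : Measurable fun p : H × ℝ => slabPotential ν β p.1 p.2 :=
  Measurable.lintegral_prod_right' (f := fun q : (H × ℝ) × H =>
    ‖q.1.2 - inner ℝ q.2 q.1.1‖ₑ ^ (-β)) (by fun_prop)

variable [OpensMeasurableSpace H] [NeZero ν]

theorem slabPotential_ne_zero (hβ : 0 ≤ β) (hv : ‖v‖ ≤ 1) (t : ℝ) :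
    slabPotential ν β v t ≠ 0 := by
  have hle : rieszPotential ν β 0 ‖t‖ₑ ≤ slabPotential ν β v t :=
    rieszPotential_le_slabPotential ν hβ hv (by simp)
  exact ((pos_iff_ne_zero.2 (rieszPotential_ne_zero ν hβ 0 enorm_ne_top)).trans_le hle).ne'

theorem coe_slabWeight (hβ : 0 ≤ β) (hN : 0 ≤ N) (hv : ‖v‖ ≤ 1) (t : ℝ) :
    (slabWeight ν β N v t : ℝ≥0∞) = slabPotential ν β v t ^ (-N) := by
  refine ENNReal.coe_toNNReal ?_
  simp [ENNReal.rpow_eq_top_iff, slabPotential_ne_zero ν hβ hv, hN]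

theorem slabWeight_le_toNNReal (hβ : 0 ≤ β) (hN : 0 ≤ N) (hv : ‖v‖ ≤ 1) {x : H} {t : ℝ}
    {r : ℝ≥0∞} (hr : r ≠ ⊤) (ht : ‖t - inner ℝ x v‖ₑ ≤ r) :
    slabWeight ν β N v t ≤ (rieszPotential ν β x r ^ (-N)).toNNReal := by
  refine ENNReal.toNNReal_mono ?_
    (ennreal_rpow_le_rpow_of_nonpos (rieszPotential_le_slabPotential ν hβ hv ht) (neg_nonpos.2 hN))
  simp [ENNReal.rpow_eq_top_iff, rieszPotential_ne_zero ν hβ x hr, hN]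

theorem isSlabWeight_slabWeight [SecondCountableTopology H] [SFinite ν] (hβ : 0 ≤ β)
    (hN : 0 ≤ N) : IsSlabWeight (slabWeight ν β N) where
  measurable := ((measurable_slabPotential ν).pow_const _).ennreal_toNNReal
  exists_forall_le R := by
    refine ⟨_, fun v t hv ht => slabWeight_le_toNNReal ν hβ hN hv (x := 0)
      (r := ENNReal.ofReal R) ENNReal.ofReal_ne_top ?_⟩
    rw [inner_zero_left, sub_zero, ← ofReal_norm]
    exact ENNReal.ofReal_le_ofReal ht

end SlabWeight

variable [FiniteDimensional ℝ H] [BorelSpace H]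

theorem exists_lintegral_slabPotential_le {β : ℝ} (hβ0 : 0 < β) (hβ1 : β < 1) :
    ∃ C : ℝ≥0, ∀ (ν : Measure H) [SFinite ν] (x y : H),
      ∫⁻ p, slabPotential ν β p.1 (inner ℝ (x + p.2 • (y - x)) p.1) ∂(ballSegment H) ≤
        C * rieszPotential ν β x (edist x y) := by
  obtain ⟨C₁, hC₁⟩ := exists_setLIntegral_closedBall_enorm_inner_rpow_neg_le (H := H) hβ0 hβ1
  obtain ⟨C₂, hC₂⟩ := exists_lintegral_enorm_add_smul_rpow_neg_le (E := H) hβ0.le hβ1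
  refine ⟨C₁ * C₂, fun ν _ x y => ?_⟩
  have hmeas : Measurable fun q : (H × ℝ) × H =>
      ‖inner ℝ (x + q.1.2 • (y - x) - q.2) q.1.1‖ₑ ^ (-β) := by fun_prop
  have hkernel : ∀ z, ∫⁻ p, ‖inner ℝ (x + p.2 • (y - x) - z) p.1‖ₑ ^ (-β) ∂(ballSegment H) ≤
      (C₁ * C₂ : ℝ≥0) * (edist x y + edist x z) ^ (-β) := fun z => by
    have hz : ∀ τ : ℝ, x + τ • (y - x) - z = x - z + τ • (y - x) := fun τ => by abel
    calc _ = ∫⁻ τ in Ioc (0 : ℝ) 1, ∫⁻ v in Metric.closedBall (0 : H) 1,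
            ‖inner ℝ (x + τ • (y - x) - z) v‖ₑ ^ (-β) :=
          lintegral_prod_symm _ (hmeas.comp measurable_prodMk_right).aemeasurable
      _ ≤ ∫⁻ τ in Ioc (0 : ℝ) 1, C₁ * ‖x - z + τ • (y - x)‖ₑ ^ (-β) := by
          simp only [hz]
          exact lintegral_mono fun τ => hC₁ _
      _ ≤ C₁ * (C₂ * (‖y - x‖ₑ + ‖x - z‖ₑ) ^ (-β)) := by
          rw [lintegral_const_mul _ (by fun_prop)]
          exact mul_le_mul_right (hC₂ _ _) _
      _ = _ := by
          rw [edist_comm x y, edist_eq_enorm_sub, edist_eq_enorm_sub, ENNReal.coe_mul, mul_assoc]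
  calc ∫⁻ p, slabPotential ν β p.1 (inner ℝ (x + p.2 • (y - x)) p.1) ∂(ballSegment H)
      = ∫⁻ p, ∫⁻ z, ‖inner ℝ (x + p.2 • (y - x) - z) p.1‖ₑ ^ (-β) ∂ν ∂(ballSegment H) := by
        simp only [slabPotential, inner_sub_left]
    _ = ∫⁻ z, ∫⁻ p, ‖inner ℝ (x + p.2 • (y - x) - z) p.1‖ₑ ^ (-β) ∂(ballSegment H) ∂ν :=
        lintegral_lintegral_swap hmeas.aemeasurable
    _ ≤ ∫⁻ z, (C₁ * C₂ : ℝ≥0) * (edist x y + edist x z) ^ (-β) ∂ν := lintegral_mono hkernel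
    _ = _ := lintegral_const_mul' _ _ ENNReal.coe_ne_top

theorem exists_le_lintegral_ballSegment_inner_sq : ∃ m : ℝ≥0, m ≠ 0 ∧ ∀ q : H,
    m * ‖q‖ₑ ^ 2 ≤ ∫⁻ p, ‖inner ℝ q p.1‖ₑ ^ 2 ∂(ballSegment H) := by
  obtain ⟨m, hm0, hm⟩ := exists_le_setLIntegral_closedBall_inner_sq (H := H)
  refine ⟨m, hm0, fun q => (hm q).trans_eq ?_⟩
  rw [lintegral_prod _ (by fun_prop)]
  simp

theorem measurable_slabPotential_inner (ν : Measure H) [SFinite ν] {β : ℝ} (x y : H) :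
    Measurable fun p : H × ℝ => slabPotential ν β p.1 (inner ℝ (x + p.2 • (y - x)) p.1) :=
  (measurable_slabPotential ν).comp (g := fun p : H × ℝ => slabPotential ν β p.1 p.2)
    (f := fun p : H × ℝ => (p.1, inner ℝ (x + p.2 • (y - x)) p.1)) (by fun_prop)

theorem lintegral_inner_sq_mul_le (x y : H) {P : H × ℝ → ℝ≥0∞} (hP : Measurable P) :
    ∫⁻ p, ‖inner ℝ (y - x) p.1‖ₑ ^ 2 * P p ∂(ballSegment H) ≤
      edist x y ^ 2 * ∫⁻ p, P p ∂(ballSegment H) := by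
  rw [← lintegral_const_mul _ hP]
  refine lintegral_mono_ae ?_
  filter_upwards [ae_ballSegment] with p hp
  gcongr
  rw [edist_comm, edist_eq_enorm_sub]
  exact enorm_le_iff_norm_le.2
    ((norm_inner_le_norm _ _).trans (mul_le_of_le_one_right (norm_nonneg _) hp.1))

/-- The superposition of the slab maps of `ν`: it stretches the segment from `x` to `y` by a factor
comparable to the power `-N` of the Riesz potential of `ν` at `x`, smoothed at the scale of the
segment. -/
noncomputable def rieszMap (ν : Measure H) (β N : ℝ) : H → H :=
  slabMap (slabWeight ν β N)

variable (ν : Measure H) [IsFiniteMeasure ν] [NeZero ν] {β N : ℝ}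

theorem edist_rieszMap_le (hβ : 0 ≤ β) (hN : 0 ≤ N) (x y : H) :
    edist (rieszMap ν β N x) (rieszMap ν β N y) ≤
      ballSegment H univ * (edist x y * rieszPotential ν β x (edist x y) ^ (-N)) := by
  have hU : rieszPotential ν β x (edist x y) ^ (-N) ≠ ⊤ := by
    simp [ENNReal.rpow_eq_top_iff, rieszPotential_ne_zero ν hβ x, edist_ne_top, hN]
  rw [← ENNReal.coe_toNNReal hU]
  refine (isSlabWeight_slabWeight ν hβ hN).edist_slabMap_le fun v t hv ht => ?_
  refine slabWeight_le_toNNReal ν hβ hN hv (edist_ne_top x y) ?_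
  rw [edist_comm, edist_eq_enorm_sub]
  exact enorm_le_iff_norm_le.2 ht

theorem ofReal_inner_rieszMap_sub (hβ : 0 ≤ β) (hN : 0 ≤ N) (x y : H) :
    ENNReal.ofReal (inner ℝ (rieszMap ν β N y - rieszMap ν β N x) (y - x)) =
      ∫⁻ p, ‖inner ℝ (y - x) p.1‖ₑ ^ 2 *
        slabPotential ν β p.1 (inner ℝ (x + p.2 • (y - x)) p.1) ^ (-N) ∂(ballSegment H) := by
  rw [rieszMap, (isSlabWeight_slabWeight ν hβ hN).ofReal_inner_slabMap_sub]
  refine lintegral_congr_ae ?_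
  filter_upwards [ae_ballSegment] with p hp
  rw [coe_slabWeight ν hβ hN hp.1]

/-- Hölder's inequality bounds the average of the power `-N` of the slab potential from below by
the power `-N` of its average. -/
theorem exists_edist_sq_mul_rpow_neg_le (hβ0 : 0 < β) (hβ1 : β < 1) (hN : 0 ≤ N) :
    ∃ K : ℝ≥0, ∀ x y : H, edist x y ^ 2 * rieszPotential ν β x (edist x y) ^ (-N) ≤
      K * ENNReal.ofReal (inner ℝ (rieszMap ν β N y - rieszMap ν β N x) (y - x)) := by
  obtain ⟨m, hm0, hm⟩ := exists_le_lintegral_ballSegment_inner_sq (H := H)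
  obtain ⟨C, hC⟩ := exists_lintegral_slabPotential_le (H := H) hβ0 hβ1
  refine ⟨m ^ (-(N + 1)) * C ^ N, fun x y => ?_⟩
  rcases eq_or_ne x y with rfl | hxy
  · simp
  have he0 : edist x y ≠ 0 := (edist_pos.2 hxy).ne'
  have hU : rieszPotential ν β x (edist x y) ≠ ⊤ := rieszPotential_ne_top ν hβ0.le x he0
  have hmeas := measurable_slabPotential_inner ν (β := β) x y
  have hP0 : ∀ᵐ p ∂(ballSegment H),
      slabPotential ν β p.1 (inner ℝ (x + p.2 • (y - x)) p.1) ≠ 0 := by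
    filter_upwards [ae_ballSegment] with p hp using slabPotential_ne_zero ν hβ0.le hp.1 _
  have hP_top : ∀ᵐ p ∂(ballSegment H),
      slabPotential ν β p.1 (inner ℝ (x + p.2 • (y - x)) p.1) ≠ ⊤ := by
    filter_upwards [ae_lt_top hmeas ((hC ν x y).trans_lt
      (ENNReal.mul_lt_top ENNReal.coe_lt_top hU.lt_top)).ne] with p hp using hp.ne
  rw [ENNReal.coe_mul, ENNReal.coe_rpow_of_ne_zero hm0, ENNReal.coe_rpow_of_nonneg _ hN,
    ofReal_inner_rieszMap_sub ν hβ0.le hN]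
  refine mul_rpow_neg_le_of_rpow_add_one_le hN (pow_ne_zero 2 he0)
    (ENNReal.pow_ne_top (edist_ne_top x y)) (by exact_mod_cast hm0) ENNReal.coe_ne_top
    (rieszPotential_ne_zero ν hβ0.le x (edist_ne_top x y)) hU ?_
  calc (m * edist x y ^ 2) ^ (N + 1)
      ≤ (∫⁻ p, ‖inner ℝ (y - x) p.1‖ₑ ^ 2 ∂(ballSegment H)) ^ (N + 1) := by
        gcongr
        rw [edist_comm, edist_eq_enorm_sub]
        exact hm (y - x)
    _ ≤ _ := lintegral_rpow_add_one_le (by fun_prop) hmeas.aemeasurable hP0 hP_top hN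
    _ ≤ _ := by
        gcongr
        exact (lintegral_inner_sq_mul_le x y hmeas).trans (mul_le_mul_right (hC ν x y) _)

theorem exists_edist_mul_rpow_neg_le (hβ0 : 0 < β) (hβ1 : β < 1) (hN : 0 ≤ N) :
    ∃ K : ℝ≥0, ∀ x y : H, edist x y * rieszPotential ν β x (edist x y) ^ (-N) ≤
      K * edist (rieszMap ν β N x) (rieszMap ν β N y) := by
  obtain ⟨K, hK⟩ := exists_edist_sq_mul_rpow_neg_le ν hβ0 hβ1 hN
  refine ⟨K, fun x y => ?_⟩
  rcases eq_or_ne x y with rfl | hxy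
  · simp
  refine (ENNReal.mul_le_mul_iff_right (edist_pos.2 hxy).ne' (edist_ne_top x y)).1 ?_
  calc edist x y * (edist x y * rieszPotential ν β x (edist x y) ^ (-N))
      ≤ K * ENNReal.ofReal (inner ℝ (rieszMap ν β N y - rieszMap ν β N x) (y - x)) := by
        rw [← mul_assoc, ← sq]; exact hK x y
    _ ≤ K * (edist (rieszMap ν β N x) (rieszMap ν β N y) * edist x y) := by
        rw [edist_comm, edist_comm x, edist_eq_enorm_sub, edist_eq_enorm_sub, ← ofReal_norm,
          ← ofReal_norm, ← ENNReal.ofReal_mul (norm_nonneg _)]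
        gcongr
        exact real_inner_le_norm _ _
    _ = _ := by ring

theorem exists_norm_mul_norm_le_inner_rieszMap (hβ0 : 0 < β) (hβ1 : β < 1) (hN : 0 ≤ N) :
    ∃ K : ℝ≥0, ∀ x y : H, ‖rieszMap ν β N y - rieszMap ν β N x‖ * ‖y - x‖ ≤
      K * inner ℝ (rieszMap ν β N y - rieszMap ν β N x) (y - x) := by
  obtain ⟨K, hK⟩ := exists_edist_sq_mul_rpow_neg_le ν hβ0 hβ1 hN
  refine ⟨(ballSegment H univ).toNNReal * K, fun x y => ?_⟩
  set Δ := rieszMap ν β N y - rieszMap ν β N x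
  have hle : ENNReal.ofReal (‖Δ‖ * ‖y - x‖) ≤
      ENNReal.ofReal (((ballSegment H univ).toNNReal * K : ℝ≥0) * inner ℝ Δ (y - x)) := by
    rw [ENNReal.ofReal_mul (norm_nonneg _), ENNReal.ofReal_mul NNReal.zero_le_coe, ofReal_norm,
      ofReal_norm, ENNReal.ofReal_coe_nnreal, ENNReal.coe_mul,
      ENNReal.coe_toNNReal (measure_ne_top _ _), ← edist_eq_enorm_sub, ← edist_eq_enorm_sub,
      edist_comm, edist_comm y]
    calc _ ≤ ballSegment H univ * (edist x y * rieszPotential ν β x (edist x y) ^ (-N)) *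
            edist x y := by gcongr; exact edist_rieszMap_le ν hβ0.le hN x y
      _ = ballSegment H univ * (edist x y ^ 2 * rieszPotential ν β x (edist x y) ^ (-N)) := by ring
      _ ≤ _ := by rw [mul_assoc]; exact mul_le_mul_right (hK x y) _
  rcases ENNReal.ofReal_le_ofReal_iff'.1 hle with h | h
  · exact h
  · have hzero : inner ℝ Δ (y - x) = 0 := by
      rw [← abs_nonpos_iff]
      exact (abs_real_inner_le_norm _ _).trans h
    rw [hzero, mul_zero]
    exact h

end RieszMap

/-! ### Quasisymmetric maps -/

/-- The three-point condition of quasisymmetry with control function `η`, for a map which is not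
assumed to be a homeomorphism. -/
def IsQuasisymmetricWith {X Y : Type*} [PseudoMetricSpace X] [PseudoMetricSpace Y]
    (η : ℝ≥0 ≃o ℝ≥0) (f : X → Y) : Prop :=
  ∀ (x y z : X) (t : ℝ≥0), 0 < t → nndist x y ≤ t * nndist x z →
    nndist (f x) (f y) ≤ η t * nndist (f x) (f z)

section QuasisymmetricWith

variable {X Y : Type*} [MetricSpace X] [MetricSpace Y] {η : ℝ≥0 ≃o ℝ≥0} {f : X → Y}

namespace IsQuasisymmetricWith

theorem nndist_map_le (hf : IsQuasisymmetricWith η f) {x z : X} (hz : x ≠ z) (y : X) :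
    nndist (f x) (f y) ≤ η (nndist x y / nndist x z) * nndist (f x) (f z) := by
  rcases eq_or_ne x y with rfl | hy
  · simp
  have hxz : nndist x z ≠ 0 := nndist_eq_zero.not.2 hz
  have hxy : nndist x y ≠ 0 := nndist_eq_zero.not.2 hy
  exact hf x y z _ (by positivity) (div_mul_cancel₀ _ hxz).ge

protected theorem continuous (hf : IsQuasisymmetricWith η f) : Continuous f := by
  rcases subsingleton_or_nontrivial X with hX | hX
  · exact continuous_of_const fun x y => congrArg f (Subsingleton.elim x y)
  refine continuous_iff_continuousAt.2 fun x => ?_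
  obtain ⟨z, hz⟩ := exists_ne x
  have hbound : Tendsto (fun y => η (nndist x y / nndist x z) * nndist (f x) (f z)) (𝓝 x)
      (𝓝 0) := by
    have hcont : Continuous fun y => η (nndist x y / nndist x z) * nndist (f x) (f z) := by
      have := η.continuous
      fun_prop
    have hη0 : η 0 = 0 := η.map_bot
    simpa [hη0] using hcont.tendsto x
  rw [ContinuousAt, tendsto_iff_dist_tendsto_zero]
  refine squeeze_zero (fun y => dist_nonneg) (fun y => ?_) (NNReal.tendsto_coe.2 hbound)
  rw [dist_comm, ← coe_nndist]
  exact hf.nndist_map_le hz.symm y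

theorem tendsto_cobounded (hf : IsQuasisymmetricWith η f) (hinj : Function.Injective f) :
    Tendsto f (Bornology.cobounded X) (Bornology.cobounded Y) := by
  rcases subsingleton_or_nontrivial X with hX | ⟨x, z, hxz⟩
  · simp
  have hfxz : 0 < nndist (f x) (f z) := pos_iff_ne_zero.2 (nndist_eq_zero.not.2 (hinj.ne hxz))
  have hdist : Tendsto (nndist x) (Bornology.cobounded X) atTop :=
    NNReal.tendsto_coe_atTop.1 (Metric.tendsto_dist_left_cobounded_atTop x)
  have hη : Tendsto (fun y => η (nndist x z / nndist x y)) (Bornology.cobounded X) (𝓝[>] 0) := by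
    have hη0 : η 0 = 0 := η.map_bot
    have hdiv : Tendsto (fun y => nndist x z / nndist x y) (Bornology.cobounded X) (𝓝 0) :=
      NNReal.tendsto_coe.1 (by
        simpa using (NNReal.tendsto_coe_atTop.2 hdist).const_div_atTop (nndist x z : ℝ))
    refine tendsto_nhdsWithin_iff.2 ⟨?_, ?_⟩
    · have h := (η.continuous.tendsto 0).comp hdiv
      rwa [hη0] at h
    · filter_upwards [hdist.eventually_gt_atTop 0] with y hy
      have hxz' : nndist x z ≠ 0 := nndist_eq_zero.not.2 hxz
      rw [mem_Ioi, ← hη0, η.lt_iff_lt]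
      positivity
  simp only [← Metric.tendsto_dist_left_atTop_iff (f x), dist_nndist]
  refine NNReal.tendsto_coe_atTop.2
    (tendsto_atTop_mono' _ ?_ (hη.inv_tendsto_nhdsGT_zero.atTop_mul_const hfxz))
  filter_upwards [hdist.eventually_gt_atTop 0, hη self_mem_nhdsWithin] with y hy hηy
  rw [Pi.inv_apply, inv_mul_le_iff₀ hηy]
  exact hf.nndist_map_le (fun h => hy.ne' (nndist_eq_zero.2 h)) z

end IsQuasisymmetricWith

end QuasisymmetricWith

theorem exists_orderIso_mul_add_rpow {K : ℝ≥0} (hK : 0 < K) {p : ℝ} (hp : 0 < p) :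
    ∃ η : ℝ≥0 ≃o ℝ≥0, ∀ t, η t = K * (t + t ^ p) := by
  have hmono : StrictMono fun t : ℝ≥0 => K * (t + t ^ p) := fun a b hab =>
    mul_lt_mul_of_pos_left (add_lt_add hab (NNReal.rpow_lt_rpow hab hp)) hK
  have hcont : Continuous fun t : ℝ≥0 => K * (t + t ^ p) := by
    have := NNReal.continuous_rpow_const hp.le
    fun_prop
  have htop : Tendsto (fun t : ℝ≥0 => K * (t + t ^ p)) atTop atTop :=
    (tendsto_atTop_mono (fun t => self_le_add_right t _) tendsto_id).const_mul_atTop hK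
  have hbot : Tendsto (fun t : ℝ≥0 => K * (t + t ^ p)) atBot atBot := by
    have hzero : K * (⊥ + ⊥ ^ p) = ⊥ := by simp [hp.ne']
    simpa only [OrderBot.atBot_eq, hzero] using
      tendsto_pure_pure (fun t : ℝ≥0 => K * (t + t ^ p)) ⊥
  exact ⟨hmono.orderIsoOfSurjective _ (hcont.surjective htop hbot), fun t => rfl⟩

section Monotone

variable {H : Type*} [NormedAddCommGroup H] [InnerProductSpace ℝ H] [ProperSpace H]

/-- Otherwise some value `f x` is closest to a point `p` outside the range, but moving `x` towards
`p - f x` moves `f x` closer to `p`. -/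
theorem surjective_of_norm_mul_norm_le_inner {f : H → H} (hf : Continuous f)
    (hinj : Function.Injective f) (hproper : Tendsto f (cocompact H) (cocompact H)) {K : ℝ≥0}
    (hmono : ∀ x y, ‖f y - f x‖ * ‖y - x‖ ≤ K * inner ℝ (f y - f x) (y - x)) :
    Function.Surjective f := by
  intro p
  have hlim : Tendsto (fun x => dist (f x) p) (cocompact H) atTop :=
    (tendsto_dist_right_cocompact_atTop p).comp hproper
  obtain ⟨x, hx⟩ := Continuous.exists_forall_le (f := fun x => dist (f x) p) (by fun_prop) hlim
  by_contra! hne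
  set q := p - f x with hq
  have hq0 : q ≠ 0 := sub_ne_zero.2 (hne x).symm
  have hsmall : Tendsto (fun t : ℝ => K * ‖f (x + t • q) - f x‖) (𝓝[>] 0) (𝓝 0) := by
    have hcont : Continuous fun t : ℝ => K * ‖f (x + t • q) - f x‖ := by fun_prop
    simpa using (hcont.tendsto 0).mono_left nhdsWithin_le_nhds
  obtain ⟨t, ht, ht0 : 0 < t⟩ := ((hsmall.eventually_lt_const
    (show (0 : ℝ) < 2 * ‖q‖ by positivity)).and self_mem_nhdsWithin).exists
  set Δ := f (x + t • q) - f x with hΔ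
  have hΔ0 : 0 < ‖Δ‖ := norm_pos_iff.2 (sub_ne_zero.2 fun h => by
    simpa [ht0.ne', hq0] using hinj h)
  have hangle : ‖Δ‖ * ‖q‖ ≤ K * inner ℝ Δ q := by
    refine le_of_mul_le_mul_left ?_ ht0
    have h := hmono x (x + t • q)
    rw [add_sub_cancel_left, inner_smul_right, norm_smul, Real.norm_of_nonneg ht0.le, ← hΔ] at h
    linarith
  have hclosest : 2 * inner ℝ Δ q ≤ ‖Δ‖ ^ 2 := by
    have h : ‖q‖ ≤ ‖Δ - q‖ := by
      simpa [dist_eq_norm, hΔ, hq, norm_sub_rev p] using hx (x + t • q)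
    have hsq : ‖q‖ ^ 2 ≤ ‖Δ - q‖ ^ 2 := by gcongr
    linarith [norm_sub_sq_real Δ q]
  have hlt : ‖Δ‖ * (K * ‖Δ‖) < ‖Δ‖ * (2 * ‖q‖) := mul_lt_mul_of_pos_left ht hΔ0
  have hle : K * (2 * inner ℝ Δ q) ≤ K * ‖Δ‖ ^ 2 := by gcongr
  linarith

theorem IsQuasisymmetricWith.exists_homeomorph {η : ℝ≥0 ≃o ℝ≥0} {f : H → H}
    (hf : IsQuasisymmetricWith η f) (hinj : Function.Injective f) {K : ℝ≥0}
    (hmono : ∀ x y, ‖f y - f x‖ * ‖y - x‖ ≤ K * inner ℝ (f y - f x) (y - x)) :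
    ∃ g : H ≃ₜ H, ⇑g = f := by
  have hproper : Tendsto f (cocompact H) (cocompact H) := by
    simpa only [Metric.cobounded_eq_cocompact] using hf.tendsto_cobounded hinj
  have hclosed : IsClosedMap f :=
    (isProperMap_iff_tendsto_cocompact.2 ⟨hf.continuous, hproper⟩).isClosedMap
  have hsurj := surjective_of_norm_mul_norm_le_inner hf.continuous hinj hproper hmono
  exact ⟨(Equiv.ofBijective f ⟨hinj, hsurj⟩).toHomeomorphOfContinuousClosed hf.continuous hclosed,
    rfl⟩

end Monotone

section RieszMap

theorem mul_rieszPotential_rpow_neg_le {X : Type*} [PseudoEMetricSpace X] [MeasurableSpace X]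
    (ν : Measure X) {β N : ℝ} (hβ : 0 ≤ β) (hN : 0 ≤ N) (x : X) {r R : ℝ≥0∞} {t : ℝ≥0}
    (hr : r ≤ t * R) :
    r * rieszPotential ν β x r ^ (-N) ≤
      (t + t ^ (1 + β * N) : ℝ≥0) * (R * rieszPotential ν β x R ^ (-N)) := by
  set T : ℝ≥0 := max 1 t
  have hT : (T ^ β : ℝ≥0) ≠ 0 := by positivity
  have hU : rieszPotential ν β x r ^ (-N) ≤
      (T ^ (β * N) : ℝ≥0) * rieszPotential ν β x R ^ (-N) := by
    have hle : rieszPotential ν β x R ≤ (T ^ β : ℝ≥0) * rieszPotential ν β x r := by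
      rw [ENNReal.coe_rpow_of_nonneg _ hβ]
      refine rieszPotential_le_rpow_mul ν hβ x (by simp [T]) ENNReal.coe_ne_top (hr.trans ?_)
      gcongr
      exact le_max_right _ _
    calc rieszPotential ν β x r ^ (-N)
        = (T ^ (β * N) : ℝ≥0) * ((T ^ β : ℝ≥0) * rieszPotential ν β x r) ^ (-N) := by
          rw [ENNReal.mul_rpow_eq_ite, if_neg (by simp [hT]), ← mul_assoc,
            ← ENNReal.coe_rpow_of_ne_zero hT, ← ENNReal.coe_mul, NNReal.rpow_mul,
            ← NNReal.rpow_add hT, add_neg_cancel, NNReal.rpow_zero, ENNReal.coe_one, one_mul]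
      _ ≤ _ := by
          exact mul_le_mul_right (ennreal_rpow_le_rpow_of_nonpos hle (neg_nonpos.2 hN)) _
  have htT : t * T ^ (β * N) ≤ t + t ^ (1 + β * N) := by
    rcases le_total t 1 with ht | ht
    · simp [T, max_eq_left ht]
    · rw [show T = t from max_eq_right ht, NNReal.rpow_add (one_pos.trans_le ht).ne',
        NNReal.rpow_one]
      exact self_le_add_left _ _
  calc r * rieszPotential ν β x r ^ (-N)
      ≤ t * R * ((T ^ (β * N) : ℝ≥0) * rieszPotential ν β x R ^ (-N)) := by gcongr
    _ = (t * T ^ (β * N) : ℝ≥0) * (R * rieszPotential ν β x R ^ (-N)) := by push_cast; ring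
    _ ≤ _ := by gcongr

variable {H : Type*} [NormedAddCommGroup H] [InnerProductSpace ℝ H] [FiniteDimensional ℝ H]
  [MeasurableSpace H] [BorelSpace H] (ν : Measure H) [IsFiniteMeasure ν] [NeZero ν] {β N : ℝ}

theorem injective_rieszMap (hβ0 : 0 < β) (hβ1 : β < 1) (hN : 0 ≤ N) :
    Function.Injective (rieszMap ν β N) := by
  obtain ⟨K, hK⟩ := exists_edist_mul_rpow_neg_le ν hβ0 hβ1 hN
  intro x y hxy
  by_contra hne
  have hU : rieszPotential ν β x (edist x y) ^ (-N) ≠ 0 := by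
    simp [ENNReal.rpow_eq_zero_iff, rieszPotential_ne_top ν hβ0.le x (edist_pos.2 hne).ne', hN]
  have h := hK x y
  rw [hxy, edist_self, mul_zero, nonpos_iff_eq_zero, mul_eq_zero, edist_eq_zero] at h
  exact h.elim hne hU

theorem exists_isQuasisymmetricWith_rieszMap (hβ0 : 0 < β) (hβ1 : β < 1) (hN : 0 ≤ N) :
    ∃ η : ℝ≥0 ≃o ℝ≥0, IsQuasisymmetricWith η (rieszMap ν β N) := by
  obtain ⟨K, hK⟩ := exists_edist_mul_rpow_neg_le ν hβ0 hβ1 hN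
  set V : ℝ≥0 := (ballSegment H univ).toNNReal
  have hV : (V : ℝ≥0∞) = ballSegment H univ := ENNReal.coe_toNNReal (measure_ne_top _ _)
  obtain ⟨η, hη⟩ := exists_orderIso_mul_add_rpow (K := V * K + 1) (by positivity)
    (p := 1 + β * N) (by positivity)
  refine ⟨η, fun x y z t _ hxyz => ?_⟩
  have hyz : edist x y ≤ t * edist x z := by
    rw [edist_nndist, edist_nndist]
    exact_mod_cast hxyz
  rw [hη, ← ENNReal.coe_le_coe, ENNReal.coe_mul, ← edist_nndist, ← edist_nndist]
  calc edist (rieszMap ν β N x) (rieszMap ν β N y)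
      ≤ V * (edist x y * rieszPotential ν β x (edist x y) ^ (-N)) :=
        hV ▸ edist_rieszMap_le ν hβ0.le hN x y
    _ ≤ V * ((t + t ^ (1 + β * N) : ℝ≥0) *
          (edist x z * rieszPotential ν β x (edist x z) ^ (-N))) := by
        exact mul_le_mul_right (mul_rieszPotential_rpow_neg_le ν hβ0.le hN x hyz) _
    _ ≤ V * ((t + t ^ (1 + β * N) : ℝ≥0) *
          (K * edist (rieszMap ν β N x) (rieszMap ν β N z))) := by
        exact mul_le_mul_right (mul_le_mul_right (hK x z) _) _
    _ = (V * K * (t + t ^ (1 + β * N)) : ℝ≥0) *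
          edist (rieszMap ν β N x) (rieszMap ν β N z) := by push_cast; ring
    _ ≤ _ := by
        gcongr
        exact self_le_add_right _ _

theorem exists_isQuasisymmetric_edist_le (hβ0 : 0 < β) (hβ1 : β < 1) (hN : 0 ≤ N) :
    ∃ f : H ≃ₜ H, IsQuasisymmetric f ∧ ∃ C : ℝ≥0, ∀ x y : H,
      edist (f x) (f y) ≤ C * (edist x y * rieszPotential ν β x (edist x y) ^ (-N)) := by
  obtain ⟨η, hη⟩ := exists_isQuasisymmetricWith_rieszMap ν hβ0 hβ1 hN
  obtain ⟨K, hK⟩ := exists_norm_mul_norm_le_inner_rieszMap ν hβ0 hβ1 hN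
  obtain ⟨f, hf⟩ := hη.exists_homeomorph (injective_rieszMap ν hβ0 hβ1 hN) hK
  refine ⟨f, ⟨η, fun x y z t => by rw [hf]; exact hη x y z t⟩,
    (ballSegment H univ).toNNReal, fun x y => ?_⟩
  rw [ENNReal.coe_toNNReal (measure_ne_top _ _), hf]
  exact edist_rieszMap_le ν hβ0.le hN x y

end RieszMap

/-! ### Covers of small quasi-Hausdorff dimension -/

section Covers

variable {X : Type*} [MetricSpace X]

theorem encard_mul_rpow_le_tsum_ediam_rpow {𝒰 : Set (Set X)} {d : ℝ≥0∞} {s : ℝ} (hs : 0 ≤ s)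
    (h𝒰 : ∀ A ∈ 𝒰, d ≤ Metric.ediam A) :
    𝒰.encard * d ^ s ≤ ∑' A : 𝒰, Metric.ediam (A : Set X) ^ s := by
  rw [← ENNReal.tsum_set_const]
  exact ENNReal.tsum_le_tsum fun A => ENNReal.rpow_le_rpow (h𝒰 A A.2) hs

theorem exists_covers_of_quasiHausdorffDim_lt {E : Set X} {d : ℝ≥0}
    (hdim : quasiHausdorffDim E < d) :
    ∃ s a δ₀ : ℝ, 0 < s ∧ s < d ∧ 0 < a ∧ 0 < δ₀ ∧ ∃ C : ℝ, 0 < C ∧ ∀ δ : ℝ, 0 < δ → δ < δ₀ →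
      ∃ 𝒰 : Set (Set X), E ⊆ ⋃₀ 𝒰 ∧
        (∀ A ∈ 𝒰, 0 < Metric.ediam A ∧ Metric.ediam A ≤ ENNReal.ofReal δ) ∧
        ∑' A : 𝒰, Metric.ediam (A : Set X) ^ s ≤ ENNReal.ofReal C ∧
        𝒰.encard ≤ ENNReal.ofReal (C * δ ^ (-a)) := by
  obtain ⟨θ, hθdim, hθ : 0 < θ⟩ := (((tendsto_intermediateDim E).eventually_lt_const hdim).and
    self_mem_nhdsWithin).exists
  simp only [intermediateDim, iInf_lt_iff] at hθdim
  obtain ⟨s, ⟨hs, C, hC, δ₀, hδ₀, hcov⟩, hsd⟩ := hθdim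
  have hs : (0 : ℝ) < s := hs
  refine ⟨s, s / θ, δ₀, hs, by exact_mod_cast hsd, by positivity, hδ₀, C, hC, fun δ hδ hδδ₀ => ?_⟩
  obtain ⟨𝒰, hE, hdiam, hsum⟩ := hcov δ hδ hδδ₀
  have hpos : 0 < δ ^ (1 / θ) := by positivity
  refine ⟨𝒰, hE, fun A hA => ⟨(ENNReal.ofReal_pos.2 hpos).trans_le (hdiam A hA).1,
    (hdiam A hA).2⟩, hsum, ?_⟩
  have hcard := (encard_mul_rpow_le_tsum_ediam_rpow hs.le fun A hA => (hdiam A hA).1).trans hsum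
  have hexp : (δ ^ (1 / θ)) ^ (s : ℝ) = δ ^ (s / θ) := by
    rw [← Real.rpow_mul hδ.le, one_div_mul_eq_div]
  rw [ENNReal.ofReal_rpow_of_pos hpos, hexp] at hcard
  rw [Real.rpow_neg hδ.le, ← div_eq_mul_inv, ENNReal.ofReal_div_of_pos (by positivity)]
  exact (ENNReal.le_div_iff_mul_le (Or.inl (by simpa using by positivity)) (Or.inl (by simp))).2
    hcard

theorem exists_dyadic_covers_of_quasiHausdorffDim_lt {E : Set X} {d : ℝ≥0}
    (hdim : quasiHausdorffDim E < d) :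
    ∃ s a C : ℝ, 0 < s ∧ s < d ∧ 0 < a ∧ 0 < C ∧ ∃ 𝒰 : ℕ → Set (Set X), ∀ k, E ⊆ ⋃₀ 𝒰 k ∧
      (∀ A ∈ 𝒰 k, 0 < Metric.ediam A ∧ Metric.ediam A ≤ 2⁻¹ ^ k) ∧
      ∑' A : 𝒰 k, Metric.ediam (A : Set X) ^ s ≤ ENNReal.ofReal C ∧
      (𝒰 k).encard ≤ ENNReal.ofReal (C * (2 ^ k) ^ a) := by
  obtain ⟨s, a, δ₀, hs, hsd, ha, hδ₀, C, hC, hcov⟩ := exists_covers_of_quasiHausdorffDim_lt hdim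
  set δ : ℝ := min (δ₀ / 2) 1
  have hδ : 0 < δ := lt_min (by linarith) one_pos
  have hδlt (k : ℕ) : δ * 2⁻¹ ^ k < δ₀ := calc
    δ * 2⁻¹ ^ k ≤ δ := mul_le_of_le_one_right hδ.le (pow_le_one₀ (by norm_num) (by norm_num))
    _ < δ₀ := by linarith [min_le_left (δ₀ / 2) 1]
  have hδle (k : ℕ) : ENNReal.ofReal (δ * 2⁻¹ ^ k) ≤ 2⁻¹ ^ k := by
    refine (ENNReal.ofReal_le_ofReal (mul_le_of_le_one_left (by positivity)
      (min_le_right _ _))).trans_eq ?_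
    rw [ENNReal.ofReal_pow (by norm_num), ENNReal.ofReal_inv_of_pos two_pos, ENNReal.ofReal_ofNat]
  choose 𝒰 hE hdiam hsum hcard using fun k : ℕ => hcov (δ * 2⁻¹ ^ k) (by positivity) (hδlt k)
  have hC' : 0 ≤ C * δ ^ (-a) := by positivity
  refine ⟨s, a, C + C * δ ^ (-a), hs, hsd, ha, by positivity, 𝒰, fun k => ⟨hE k, fun A hA =>
    ⟨(hdiam k A hA).1, (hdiam k A hA).2.trans (hδle k)⟩, (hsum k).trans
    (ENNReal.ofReal_le_ofReal (by linarith)), (hcard k).trans (ENNReal.ofReal_le_ofReal ?_)⟩⟩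
  rw [Real.mul_rpow hδ.le (by positivity), inv_pow, Real.inv_rpow (by positivity),
    Real.rpow_neg (by positivity : (0 : ℝ) ≤ 2 ^ k), inv_inv, ← mul_assoc]
  gcongr
  linarith

theorem tsum_tsum_ediam_rpow_lt_top {𝒰 : ℕ → Set (Set X)} {s t : ℝ} {C : ℝ≥0∞} (hC : C ≠ ⊤)
    (hs : 0 ≤ s) (hst : s < t) (hdiam : ∀ k, ∀ A ∈ 𝒰 k, Metric.ediam A ≤ 2⁻¹ ^ k)
    (hsum : ∀ k, ∑' A : 𝒰 k, Metric.ediam (A : Set X) ^ s ≤ C) :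
    ∑' k, ∑' A : 𝒰 k, Metric.ediam (A : Set X) ^ t < ⊤ := by
  have hterm (k : ℕ) (A : 𝒰 k) : Metric.ediam (A : Set X) ^ t ≤
      Metric.ediam (A : Set X) ^ s * (2⁻¹ ^ (t - s)) ^ k := calc
    Metric.ediam (A : Set X) ^ t
        = Metric.ediam (A : Set X) ^ s * Metric.ediam (A : Set X) ^ (t - s) := by
      rw [← ENNReal.rpow_add_of_nonneg _ _ hs (sub_nonneg.2 hst.le), add_sub_cancel]
    _ ≤ Metric.ediam (A : Set X) ^ s * (2⁻¹ ^ k) ^ (t - s) :=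
      mul_le_mul_right (ENNReal.rpow_le_rpow (hdiam k A A.2) (sub_nonneg.2 hst.le)) _
    _ = _ := by simp only [← ENNReal.rpow_natCast, ← ENNReal.rpow_mul, mul_comm]
  have hratio : (2⁻¹ : ℝ≥0∞) ^ (t - s) < 1 := ENNReal.rpow_lt_one (by simp) (sub_pos.2 hst)
  calc ∑' k, ∑' A : 𝒰 k, Metric.ediam (A : Set X) ^ t
      ≤ ∑' k, C * (2⁻¹ ^ (t - s)) ^ k := by
        refine ENNReal.tsum_le_tsum fun k => (ENNReal.tsum_le_tsum (hterm k)).trans ?_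
        rw [ENNReal.tsum_mul_right]
        exact mul_le_mul_left (hsum k) _
    _ = C * (1 - 2⁻¹ ^ (t - s))⁻¹ := by rw [ENNReal.tsum_mul_left, ENNReal.tsum_geometric]
    _ < ⊤ := ENNReal.mul_lt_top hC.lt_top (ENNReal.inv_lt_top.2 (tsub_pos_of_lt hratio))

theorem exists_isFiniteMeasure_forall_le {ι Y : Type*} [MeasurableSpace Y] [Nonempty Y]
    {A : ι → Set Y} (hA : ∀ i, (A i).Nonempty) {w : ι → ℝ≥0∞} (hw : ∑' i, w i ≠ ⊤) :
    ∃ ν : Measure Y, IsFiniteMeasure ν ∧ NeZero ν ∧ ∀ i, w i ≤ ν (A i) := by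
  choose p hp using hA
  set μ : Measure Y := Measure.sum fun i => w i • Measure.dirac (p i) with hμ
  have : IsFiniteMeasure μ := ⟨by simpa [hμ, lt_top_iff_ne_top] using hw⟩
  refine ⟨μ + Measure.dirac (Classical.arbitrary Y), inferInstance, ⟨fun h => ?_⟩, fun i => ?_⟩
  · simpa using congrArg (· univ) h
  · calc w i = (w i • Measure.dirac (p i)) (A i) := by
          rw [Measure.smul_apply, Measure.dirac_apply_of_mem (hp i), smul_eq_mul, mul_one]
      _ ≤ μ (A i) := Measure.le_sum (fun i => w i • Measure.dirac (p i)) i (A i)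
      _ ≤ (μ + Measure.dirac (Classical.arbitrary Y)) (A i) := by
          rw [Measure.add_apply]
          exact self_le_add_right _ _

theorem exists_isFiniteMeasure_ediam_rpow_le [MeasurableSpace X] [Nonempty X]
    {𝒰 : ℕ → Set (Set X)} {s t : ℝ} {C : ℝ≥0∞} (hC : C ≠ ⊤) (hs : 0 ≤ s) (hst : s < t)
    (hdiam : ∀ k, ∀ A ∈ 𝒰 k, 0 < Metric.ediam A ∧ Metric.ediam A ≤ 2⁻¹ ^ k)
    (hsum : ∀ k, ∑' A : 𝒰 k, Metric.ediam (A : Set X) ^ s ≤ C) :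
    ∃ ν : Measure X, IsFiniteMeasure ν ∧ NeZero ν ∧
      ∀ k, ∀ A ∈ 𝒰 k, Metric.ediam A ^ t ≤ ν A := by
  have hfin : ∑' i : Σ k, 𝒰 k, Metric.ediam (i.2 : Set X) ^ t ≠ ⊤ := by
    rw [ENNReal.tsum_sigma']
    exact (tsum_tsum_ediam_rpow_lt_top hC hs hst (fun k A hA => (hdiam k A hA).2) hsum).ne
  obtain ⟨ν, hν, hν0, hle⟩ := exists_isFiniteMeasure_forall_le
    (A := fun i : Σ k, 𝒰 k => (i.2 : Set X)) (fun i => nonempty_iff_ne_empty.2 fun h => by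
      simpa [h] using (hdiam i.1 i.2 i.2.2).1) hfin
  exact ⟨ν, hν, hν0, fun k A hA => hle ⟨k, A, hA⟩⟩

theorem ediam_image_le_of_edist_le_rieszPotential [MeasurableSpace X] [OpensMeasurableSpace X]
    {Y : Type*} [PseudoEMetricSpace Y] {ν : Measure X} {f : X → Y} {β N t : ℝ} {C : ℝ≥0∞}
    (hβ : 0 ≤ β) (hN : 0 ≤ N)
    (hf : ∀ x y, edist (f x) (f y) ≤ C * (edist x y * rieszPotential ν β x (edist x y) ^ (-N)))
    {A : Set X} (hA0 : Metric.ediam A ≠ 0) (hAtop : Metric.ediam A ≠ ⊤)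
    (hA : Metric.ediam A ^ t ≤ ν A) :
    Metric.ediam (f '' A) ≤ C * 2 ^ (β * N) * Metric.ediam A ^ (1 + (β - t) * N) := by
  set d := Metric.ediam A
  have hU {x : X} (hx : x ∈ A) : 2 ^ (-β) * d ^ (t - β) ≤ rieszPotential ν β x d := calc
    2 ^ (-β) * d ^ (t - β) = (d + d) ^ (-β) * d ^ t := by
      rw [← two_mul, ENNReal.mul_rpow_of_ne_top (by simp) hAtop, mul_assoc,
        ← ENNReal.rpow_add _ _ hA0 hAtop, neg_add_eq_sub]
    _ ≤ (d + d) ^ (-β) * ν A := mul_le_mul_right hA _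
    _ ≤ rieszPotential ν β x d :=
      rpow_mul_measure_le_rieszPotential ν hβ fun y hy => Metric.edist_le_ediam_of_mem hx hy
  refine Metric.ediam_image_le_iff.2 fun x hx y hy => ?_
  have hxy : edist x y ≤ d := Metric.edist_le_ediam_of_mem hx hy
  calc edist (f x) (f y) ≤ C * (edist x y * rieszPotential ν β x (edist x y) ^ (-N)) := hf x y
    _ ≤ C * (d * (2 ^ (-β) * d ^ (t - β)) ^ (-N)) :=
      mul_le_mul_right (mul_le_mul' hxy (ennreal_rpow_le_rpow_of_nonpos
        ((hU hx).trans (rieszPotential_anti ν hβ x hxy)) (neg_nonpos.2 hN))) _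
    _ = C * 2 ^ (β * N) * d ^ (1 + (β - t) * N) := by
      rw [ENNReal.mul_rpow_of_ne_zero (by simp) (by simp [hA0, hAtop]), ← ENNReal.rpow_mul,
        ← ENNReal.rpow_mul, neg_mul_neg, mul_neg, ← neg_mul, neg_sub,
        ENNReal.rpow_add _ _ hA0 hAtop, ENNReal.rpow_one]
      ring

end Covers

/-! ### Growth of covering numbers -/

section CoveringGrowth

variable {X : Type*} [MetricSpace X]

theorem diamCoveringNumber_mono {F G : Set X} (h : F ⊆ G) (r : ℝ) :
    diamCoveringNumber F r ≤ diamCoveringNumber G r :=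
  le_iInf₂ fun 𝒰 h𝒰 => iInf₂_le 𝒰 ⟨h.trans h𝒰.1, h𝒰.2⟩

theorem diamCoveringNumber_anti (F : Set X) : Antitone (diamCoveringNumber F) := fun _ _ h =>
  le_iInf₂ fun 𝒰 h𝒰 => iInf₂_le 𝒰
    ⟨h𝒰.1, fun A hA => (h𝒰.2 A hA).trans (ENNReal.ofReal_le_ofReal h)⟩

theorem diamCoveringNumber_image_le {X Y : Type*} [MetricSpace Y] {E : Set X} {f : X → Y}
    {𝒰 : Set (Set X)} (hE : E ⊆ ⋃₀ 𝒰) {r : ℝ}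
    (h𝒰 : ∀ A ∈ 𝒰, Metric.ediam (f '' A) ≤ ENNReal.ofReal r) :
    diamCoveringNumber (f '' E) r ≤ 𝒰.encard := by
  refine (iInf₂_le ((f '' ·) '' 𝒰) ⟨?_, forall_mem_image.2 h𝒰⟩).trans (encard_image_le _ _)
  rintro _ ⟨x, hx, rfl⟩
  obtain ⟨A, hA, hxA⟩ := hE hx
  exact ⟨f '' A, mem_image_of_mem _ hA, mem_image_of_mem f hxA⟩

theorem diamCoveringNumber_univ_coe_le (F : Set X) (r : ℝ) :
    diamCoveringNumber (univ : Set F) r ≤ diamCoveringNumber F r := by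
  refine le_iInf₂ fun 𝒰 h𝒰 => ?_
  refine (iInf₂_le ((fun A => ((↑) : F → X) ⁻¹' A) '' 𝒰) ⟨?_, ?_⟩).trans (encard_image_le _ _)
  · rintro ⟨x, hx⟩ -
    obtain ⟨A, hA, hxA⟩ := h𝒰.1 hx
    exact ⟨_, mem_image_of_mem _ hA, hxA⟩
  · refine forall_mem_image.2 fun A hA => le_trans ?_ (h𝒰.2 A hA)
    exact Metric.ediam_le fun x hx y hy => Metric.edist_le_ediam_of_mem (s := A) hx hy

theorem ediam_ne_top_of_diamCoveringNumber_ne_top {F : Set X} {r : ℝ}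
    (h : diamCoveringNumber F r ≠ ⊤) : Metric.ediam F ≠ ⊤ := by
  simp only [diamCoveringNumber, ← lt_top_iff_ne_top, iInf_lt_iff] at h
  obtain ⟨𝒰, ⟨hF, hdiam⟩, hfin⟩ := h
  have hbdd : Bornology.IsBounded (⋃₀ 𝒰) :=
    (Bornology.isBounded_sUnion (encard_lt_top_iff.1 hfin)).2 fun A hA =>
      Metric.isBounded_iff_ediam_ne_top.2 (ne_top_of_le_ne_top ENNReal.ofReal_ne_top (hdiam A hA))
  exact (hbdd.subset hF).ediam_ne_top

/-- `F` has covering growth of order `s` if `N(F, r) ≲ 1 + r⁻ˢ` for all `r > 0`. This bounds both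
the box-counting dimension and the Assouad spectrum of `F`; the summand `1` accounts for the scales
`r` exceeding the diameter of `F`. -/
def HasCoveringGrowth (F : Set X) (s : ℝ) : Prop :=
  ∃ C : ℝ, 0 < C ∧ ∀ r : ℝ, 0 < r →
    (diamCoveringNumber F r : ℝ≥0∞) ≤ ENNReal.ofReal (C * (1 + r ^ (-s)))

theorem hasCoveringGrowth_of_dyadic {F : Set X} {a M L C : ℝ} (ha : 0 ≤ a) (hM : 0 < M)
    (hL : 0 < L) (hC : 0 < C) (hF : ∀ k : ℕ, (diamCoveringNumber F (L * (2 ^ k) ^ (-M)) : ℝ≥0∞) ≤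
      ENNReal.ofReal (C * (2 ^ k) ^ a)) : HasCoveringGrowth F (a / M) := by
  have hF' {k : ℕ} {r : ℝ} (hr : L * (2 ^ k) ^ (-M) ≤ r) :
      (diamCoveringNumber F r : ℝ≥0∞) ≤ ENNReal.ofReal (C * (2 ^ k) ^ a) :=
    (ENat.toENNReal_le.2 (diamCoveringNumber_anti F hr)).trans (hF k)
  refine ⟨C * (1 + 2 ^ a * L ^ (a / M)), by positivity, fun r hr => ?_⟩
  rcases le_or_gt L r with hLr | hrL
  · refine (hF' (k := 0) (by simpa using hLr)).trans (ENNReal.ofReal_le_ofReal ?_)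
    rw [pow_zero, Real.one_rpow, mul_assoc]
    exact mul_le_mul_of_nonneg_left (one_le_mul_of_one_le_of_one_le
      (le_add_of_nonneg_right (by positivity)) (le_add_of_nonneg_right (by positivity))) hC.le
  · set u : ℝ := (L / r) ^ M⁻¹
    have hu : 1 ≤ u := Real.one_le_rpow ((one_le_div hr).2 hrL.le) (by positivity)
    have huM : u ^ M = L / r := Real.rpow_inv_rpow (by positivity) hM.ne'
    obtain ⟨k, hku, huk⟩ := exists_nat_pow_near hu one_lt_two
    have hrk : L * (2 ^ (k + 1)) ^ (-M) ≤ r := by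
      rw [Real.rpow_neg (by positivity), ← div_eq_mul_inv]
      refine div_le_of_le_mul₀ (by positivity) hr.le ?_
      rw [← div_le_iff₀' hr, ← huM]
      gcongr
    refine (hF' hrk).trans (ENNReal.ofReal_le_ofReal ?_)
    calc C * (2 ^ (k + 1)) ^ a ≤ C * (2 * u) ^ a := by
          rw [pow_succ']
          gcongr
      _ = C * (2 ^ a * L ^ (a / M) * r ^ (-(a / M))) := by
          rw [Real.mul_rpow zero_le_two (by positivity), ← Real.rpow_mul (by positivity),
            inv_mul_eq_div, Real.div_rpow hL.le hr.le, Real.rpow_neg hr.le, div_eq_mul_inv,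
            mul_assoc]
      _ ≤ C * (1 + 2 ^ a * L ^ (a / M)) * (1 + r ^ (-(a / M))) := by
          rw [mul_assoc C (1 + _)]
          gcongr <;> exact le_add_of_nonneg_left zero_le_one

theorem hasCoveringGrowth_image {X Y : Type*} [MetricSpace Y] {E : Set X} {f : X → Y}
    {𝒰 : ℕ → Set (Set X)} {a M C : ℝ} {L : ℝ≥0∞} (ha : 0 ≤ a) (hM : 0 < M) (hC : 0 < C)
    (hL : L ≠ ⊤) (hE : ∀ k, E ⊆ ⋃₀ 𝒰 k)
    (hcard : ∀ k, (𝒰 k).encard ≤ ENNReal.ofReal (C * (2 ^ k) ^ a))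
    (hdiam : ∀ k, ∀ A ∈ 𝒰 k, Metric.ediam (f '' A) ≤ L * (2⁻¹ ^ k) ^ M) :
    HasCoveringGrowth (f '' E) (a / M) := by
  have hL' : 0 < L.toReal + 1 := by positivity
  have hdiam' (k : ℕ) (A : Set X) (hA : A ∈ 𝒰 k) :
      Metric.ediam (f '' A) ≤ ENNReal.ofReal ((L.toReal + 1) * (2 ^ k) ^ (-M)) := calc
    Metric.ediam (f '' A) ≤ L * (2⁻¹ ^ k) ^ M := hdiam k A hA
    _ ≤ ENNReal.ofReal (L.toReal + 1) * (2⁻¹ ^ k) ^ M :=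
      mul_le_mul_left ((ENNReal.ofReal_toReal hL).ge.trans
        (ENNReal.ofReal_le_ofReal (le_add_of_nonneg_right zero_le_one))) _
    _ = ENNReal.ofReal ((L.toReal + 1) * (2 ^ k) ^ (-M)) := by
      rw [ENNReal.ofReal_mul hL'.le, ← ENNReal.ofReal_rpow_of_pos (by positivity),
        ENNReal.ofReal_pow zero_le_two, ENNReal.ofReal_ofNat, ENNReal.rpow_neg,
        ← ENNReal.inv_rpow,
        ENNReal.inv_pow]
  exact hasCoveringGrowth_of_dyadic ha hM hL' hC fun k =>
    (ENat.toENNReal_le.2 (diamCoveringNumber_image_le (hE k) (hdiam' k))).trans (hcard k)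

namespace HasCoveringGrowth

variable {F : Set X}

theorem univ_coe {s : ℝ} (hF : HasCoveringGrowth F s) : HasCoveringGrowth (univ : Set F) s := by
  obtain ⟨C, hC, hF⟩ := hF
  exact ⟨C, hC, fun r hr =>
    (ENat.toENNReal_le.2 (diamCoveringNumber_univ_coe_le F r)).trans (hF r hr)⟩

theorem ediam_ne_top {s : ℝ} (hF : HasCoveringGrowth F s) : Metric.ediam F ≠ ⊤ := by
  obtain ⟨C, -, hF⟩ := hF
  exact ediam_ne_top_of_diamCoveringNumber_ne_top (r := 1)
    (by simpa using ne_top_of_le_ne_top ENNReal.ofReal_ne_top (hF 1 one_pos))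

theorem assouadSpectrum_le {θ : ℝ} {s : ℝ≥0} (hθ0 : 0 < θ) (hθ1 : θ < 1) (hs : 0 < s)
    (hF : HasCoveringGrowth F ((1 - θ) * s)) : assouadSpectrum θ F ≤ s := by
  obtain ⟨C, hC, hF⟩ := hF
  refine iInf₂_le s ⟨hs, C * 2, by positivity, fun x _ r R hr hR hrR hRR hR1 => ?_⟩
  refine (ENat.toENNReal_le.2 (diamCoveringNumber_mono inter_subset_right r)).trans
    ((hF r hr).trans (ENNReal.ofReal_le_ofReal ?_))
  have hr1 : r < 1 := hrR.trans_lt (hRR.trans hR1)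
  have hone : 1 ≤ r ^ (-((1 - θ) * s)) :=
    Real.one_le_rpow_of_pos_of_le_one_of_nonpos hr hr1.le
      (neg_nonpos.2 (mul_nonneg (by linarith) s.coe_nonneg))
  have hrθ : r ^ θ ≤ R := calc
    r ^ θ ≤ (R ^ (1 / θ)) ^ θ := Real.rpow_le_rpow hr.le hrR hθ0.le
    _ = R := by rw [← Real.rpow_mul hR.le, one_div_mul_cancel hθ0.ne', Real.rpow_one]
  have hpow : r ^ (-((1 - θ) * s)) ≤ (R / r) ^ (s : ℝ) := calc
    r ^ (-((1 - θ) * s)) = (r ^ θ / r) ^ (s : ℝ) := by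
      rw [← Real.rpow_sub_one hr.ne', ← Real.rpow_mul hr.le, ← neg_mul, neg_sub]
    _ ≤ (R / r) ^ (s : ℝ) := by gcongr
  rw [mul_assoc]
  gcongr
  linarith

theorem boxDim_le {s : ℝ≥0} (hs : 0 < s) (hF : HasCoveringGrowth F s) : boxDim F ≤ s := by
  have hFtop := hF.ediam_ne_top
  obtain ⟨C, hC, hF⟩ := hF
  refine iInf₂_le s ⟨hs, C * (Metric.diam F ^ (s : ℝ) + 1), by positivity, fun r hr hrF => ?_⟩
  refine (hF r hr).trans (ENNReal.ofReal_le_ofReal ?_)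
  have hrF : r ≤ Metric.diam F := (ENNReal.ofReal_le_iff_le_toReal hFtop).1 hrF.le
  have hone : 1 ≤ Metric.diam F ^ (s : ℝ) * r ^ (-(s : ℝ)) := by
    rw [Real.rpow_neg hr.le, ← div_eq_mul_inv, one_le_div (by positivity)]
    gcongr
  rw [mul_assoc]
  gcongr
  linarith

end HasCoveringGrowth

end CoveringGrowth

/-! ### Images of small dimension -/

section SmallImage

variable {H : Type*} [NormedAddCommGroup H] [InnerProductSpace ℝ H] [FiniteDimensional ℝ H]

theorem exists_isQuasisymmetric_hasCoveringGrowth {E : Set H} (hdim : quasiHausdorffDim E < 1)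
    {ε : ℝ} (hε : 0 < ε) :
    ∃ f : H ≃ₜ H, IsQuasisymmetric f ∧ HasCoveringGrowth (f '' E) ε := by
  borelize H
  obtain ⟨s, a, C, hs, hs1, ha, hC, 𝒰, h𝒰⟩ := exists_dyadic_covers_of_quasiHausdorffDim_lt
    (d := 1) (by simpa using hdim)
  choose hE hdiam hsum hcard using h𝒰
  obtain ⟨t, hst, ht1⟩ := exists_between hs1
  obtain ⟨β, htβ, hβ1 : β < 1⟩ := exists_between ht1
  have hβ : 0 < β := hs.trans (hst.trans htβ)
  set M : ℝ := a / ε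
  have hM : 0 < M := by positivity
  set N : ℝ := M / (β - t)
  have hN : 0 ≤ N := div_nonneg hM.le (sub_nonneg.2 htβ.le)
  have hNM : (β - t) * N = M := mul_div_cancel₀ M (sub_pos.2 htβ).ne'
  obtain ⟨ν, _, _, hν⟩ :=
    exists_isFiniteMeasure_ediam_rpow_le ENNReal.ofReal_ne_top hs.le hst hdiam hsum
  obtain ⟨f, hf, K, hfK⟩ := exists_isQuasisymmetric_edist_le ν hβ hβ1 hN
  refine ⟨f, hf, ?_⟩
  have himage (k : ℕ) (A : Set H) (hA : A ∈ 𝒰 k) :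
      Metric.ediam (f '' A) ≤ K * 2 ^ (β * N) * (2⁻¹ ^ k) ^ M := by
    obtain ⟨hA0, hAk⟩ := hdiam k A hA
    have hpow : (2⁻¹ : ℝ≥0∞) ^ k ≤ 1 := pow_le_one₀ zero_le (by simp)
    calc Metric.ediam (f '' A)
        ≤ K * 2 ^ (β * N) * Metric.ediam A ^ (1 + (β - t) * N) :=
          ediam_image_le_of_edist_le_rieszPotential hβ.le hN hfK hA0.ne'
            (ne_top_of_le_ne_top (by finiteness) hAk) (hν k A hA)
      _ ≤ K * 2 ^ (β * N) * (2⁻¹ ^ k) ^ (1 + M) := by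
          rw [hNM]
          exact mul_le_mul_right (ENNReal.rpow_le_rpow hAk (by positivity)) _
      _ ≤ K * 2 ^ (β * N) * (2⁻¹ ^ k) ^ M :=
          mul_le_mul_right (ENNReal.rpow_le_rpow_of_exponent_ge hpow (by linarith)) _
  have hgrowth := hasCoveringGrowth_image ha.le hM hC
    (ENNReal.mul_ne_top ENNReal.coe_ne_top (by finiteness)) hE hcard himage
  rwa [div_div_cancel₀ ha.ne'] at hgrowth

end SmallImage

/-! ### Consequences for the dimensions -/

theorem IsQuasisymmetric.isQuasiconformal {n : ℕ}
    {f : EuclideanSpace ℝ (Fin n) ≃ₜ EuclideanSpace ℝ (Fin n)} (hf : IsQuasisymmetric f) :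
    IsQuasiconformal f := by
  refine ⟨?_, fun _ => hf⟩
  obtain ⟨η, hη⟩ := hf
  refine ⟨η 1, fun x => limsup_le_of_le (h := Eventually.of_forall fun r => ?_)⟩
  refine ENNReal.div_le_of_le_mul (iSup₂_le fun y hy => ?_)
  have hη1 : (η 1 : ℝ≥0∞) ≠ 0 :=
    ENNReal.coe_ne_zero.2 (zero_le.trans_lt (η.strictMono zero_lt_one)).ne'
  simp only [ENNReal.mul_iInf_of_ne hη1 ENNReal.coe_ne_top]
  refine le_iInf₂ fun z hz => ?_
  rw [edist_nndist, edist_nndist, ← ENNReal.coe_mul, ENNReal.coe_le_coe]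
  refine hη x y z 1 one_pos ?_
  rw [one_mul, ← NNReal.coe_le_coe, coe_nndist, coe_nndist, dist_comm x, dist_comm x,
    Metric.mem_sphere.1 hy, Metric.mem_sphere.1 hz]

theorem IsQuasisymmetric.image {X Y : Type*} [MetricSpace X] [MetricSpace Y] {f : X ≃ₜ Y}
    (hf : IsQuasisymmetric f) (E : Set X) : IsQuasisymmetric (f.image E) := by
  obtain ⟨η, hη⟩ := hf
  exact ⟨η, fun x y z t ht h => hη x y z t ht h⟩

theorem conformalBoxDim_le_boxDim_image {X Y : Type} [MetricSpace X] [MetricSpace Y] {f : X ≃ₜ Y}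
    (hf : IsQuasisymmetric f) (E : Set X) :
    conformalBoxDim E ≤ boxDim (univ : Set (f '' E)) :=
  iInf_le_of_le (f '' E : Set Y) <| iInf_le_of_le Subtype.metricSpace <|
    iInf₂_le (f.image E) (hf.image E)

theorem ennreal_eq_zero_of_forall_le_coe {a : ℝ≥0∞} (h : ∀ s : ℝ≥0, 0 < s → a ≤ s) : a = 0 :=
  le_antisymm (ENNReal.le_of_forall_pos_le_add fun s hs _ => by simpa using h s hs) zero_le

theorem mainTheorem5_general {H : Type} [NormedAddCommGroup H] [InnerProductSpace ℝ H]
    [FiniteDimensional ℝ H] (E : Set H) (hdim : quasiHausdorffDim E < 1) :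
    (∀ θ : ℝ, 0 < θ → θ < 1 →
      (⨅ (f : H ≃ₜ H) (_ : IsQuasisymmetric f), assouadSpectrum θ (f '' E)) = 0) ∧
    conformalBoxDim E = 0 := by
  refine ⟨fun θ hθ0 hθ1 => ennreal_eq_zero_of_forall_le_coe fun s hs => ?_,
    ennreal_eq_zero_of_forall_le_coe fun s hs => ?_⟩
  · obtain ⟨f, hf, hgrowth⟩ := exists_isQuasisymmetric_hasCoveringGrowth hdim
      (mul_pos (sub_pos.2 hθ1) (NNReal.coe_pos.2 hs))
    exact (iInf₂_le f hf).trans (hgrowth.assouadSpectrum_le hθ0 hθ1 hs)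
  · obtain ⟨f, hf, hgrowth⟩ :=
      exists_isQuasisymmetric_hasCoveringGrowth hdim (NNReal.coe_pos.2 hs)
    exact (conformalBoxDim_le_boxDim_image hf E).trans (hgrowth.univ_coe.boxDim_le hs)

theorem mainTheorem5 (n : ℕ) (E : Set (EuclideanSpace ℝ (Fin n)))
    (hE : Bornology.IsBounded E) (hdim : quasiHausdorffDim E < 1) :
    (∀ θ : ℝ, 0 < θ → θ < 1 →
      (⨅ (f : EuclideanSpace ℝ (Fin n) ≃ₜ EuclideanSpace ℝ (Fin n)) (_ : IsQuasiconformal f),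
        assouadSpectrum θ (f '' E)) = (0 : ℝ≥0∞)) ∧
    conformalBoxDim E = 0 := by
  obtain ⟨hspec, hbox⟩ := mainTheorem5_general E hdim
  exact ⟨fun θ hθ0 hθ1 => le_antisymm ((iInf_mono fun f => iInf_mono' fun hf =>
    ⟨hf.isQuasiconformal, le_rfl⟩).trans_eq (hspec θ hθ0 hθ1)) zero_le, hbox⟩
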